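/- Let $A=(a_{ij})_{i,j\in I}$ be a symmetrizable generalized Cartan matrix with $I$ finite. Let $P^\vee$ be a free abelian group of finite rank, $P=\mathrm{Hom}_{\mathbb Z}(P^\vee,\mathbb Z)$, and let $h_i\in P^\vee$ and $\alpha_i\in P$ $(i\in I)$ be linearly independent families (simple coroots and simple roots) with $\langle\alpha_j,h_i\rangle=a_{ij}$. Put $\mathfrak h^*_{\mathbb R}=\mathbb R\otimes_{\mathbb Z}P$, let $W\subset GL(\mathfrak h^*_{\mathbb R})$ be the Weyl group, generated by $s_i(\mu)=\mu-\langle\mu,h_i\rangle\alpha_i$, and let $\overline C=\{\lambda\in\mathfrak h^*_{\mathbb R}\mid\langle\lambda,h_i\rangle\ge 0\ (i\in I)\}$. *Continuous crystals.* A continuous crystal is a set $B$ with maps $\mathrm{wt}:B\to\mathfrak h^*_{\mathbb R}$, $\varepsilon_i,\varphi_i:B\to\mathbb R\cup\{-\infty\}$ and $\widetilde e_i^r:B\to B\cup\{\mathbf 0\}$ $(i\in I,\ r\in\mathbb R)$, where $\widetilde e_i^r\mathbf 0=\mathbf 0$, such that for all $b\in B$, $i\in I$ and $r,s\in\mathbb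 R$: $\varphi_i(b)=\langle\mathrm{wt}(b),h_i\rangle+\varepsilon_i(b)$; if $\widetilde e_i^rb\ne\mathbf 0$, then $\varepsilon_i(\widetilde e_i^rb)=\varepsilon_i(b)-r$, $\varphi_i(\widetilde e_i^rb)=\varphi_i(b)+r$, $\mathrm{wt}(\widetilde e_i^rb)=\mathrm{wt}(b)+r\alpha_i$ and $\widetilde e_i^{r+s}b=\widetilde e_i^s\widetilde e_i^rb$; $\widetilde e_i^0b=b$; and $\widetilde e_i^rb=\mathbf 0$ if $r\ne0$ and $\varphi_i(b)=-\infty$. A subcrystal of a continuous crystal $B$ is a subset $S\subset B$ with $\widetilde e_i^r(S)\subset S\cup\{\mathbf 0\}$ for all $i,r$, which is a continuous crystal with respect to the restricted maps. *The path crystal.* Let $\mathscr C$ be the set of continuous maps $\pi:[0,1]\to\mathfrak h^*_{\mathbb R}$ with $\pi(0)=0$. For $\pi\in\mathscr C$ and $i\in I$ put $m_i=\inf_{t\in[0,1]}\langle\pi(t),h_i\rangle$, $\mathrm{wt}(\pi)=\pi(1)$, $\varepsilon_i(\pi)=-m_i$, $\varphi_i(\pi)=\langle\pi(1),h_i\rangle-m_i$,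 and for $r\in\mathbb R$ $$(\widetilde e_i^r\pi)(t)=\begin{cases}\pi(t)-\min\bigl\{-r,\ \inf_{s\in[t,1]}\langle\pi(s),h_i\rangle-m_i\bigr\}\alpha_i,&-\langle\pi(1),h_i\rangle+m_i\le r\le0,\\[2pt]\pi(t)-\min\bigl\{0,\ -r-m_i+\inf_{s\in[0,t]}\langle\pi(s),h_i\rangle\bigr\}\alpha_i,&0\le r\le-m_i,\end{cases}$$ and $\widetilde e_i^r\pi=\mathbf 0$ for all other $r$. For $r\ge0$ write $\widetilde f_i^r=\widetilde e_i^{-r}$, and for $\pi\in\mathscr C$ let $$\mathscr F(\pi)=\bigl\{\widetilde f_{i_1}^{r_1}\cdots\widetilde f_{i_k}^{r_k}\pi\ \bigm|\ k\ge0,\ i_1,\dots,i_k\in I,\ r_1,\dots,r_k\ge 0\bigr\}\setminus\{\mathbf 0\}.$$ *The set $\mathscr B(\lambda)$.* A positive real root is an element $\beta=w\alpha_i$ ($w\in W$, $i\in I$) that is a linear combination of simple roots with non-negative integer coefficients; its coroot and reflection are given by $\langle\mu,h_\beta\rangle=\langle w^{-1}\mu,h_i\rangle$ and $s_\beta(\mu)=\mu-\langle\mu,h_\beta\rangle\beta$.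 Let $\lambda\in\overline C$. For $\mu,\nu\in W\lambda$ write $\nu\ge\mu$ if there are $\nu=\nu_0,\nu_1,\dots,\nu_s=\mu$ $(s\ge0)$ and positive real roots $\beta_1,\dots,\beta_s$ with $\langle\nu_{k-1},h_{\beta_k}\rangle<0$ and $\nu_k=s_{\beta_k}(\nu_{k-1})$ for $1\le k\le s$; write $\nu>\mu$ if $\nu\geq\mu$ and $\nu\neq\mu$. Let $\mathscr B(\lambda)$ be the set of pairs consisting of a sequence $\nu_1>\dots>\nu_s$ in $W\lambda$ and real numbers $0=a_0<a_1<\dots<a_s=1$, each regarded as the piecewise linear path $\pi\in\mathscr C$ given by $$\pi(t)=\sum_{k=1}^{i-1}(a_k-a_{k-1})\nu_k+(t-a_{i-1})\nu_i\qquad(a_{i-1}\le t\le a_i,\ 1\le i\le s).$$ Let $\pi_\lambda\in\mathscr B(\lambda)$ be the path $\pi_\lambda(t)=t\lambda$. **Proposition.** Let $\lambda\in\overline C$. The set $\mathscr B(\lambda)\cup\{\mathbf 0\}$ is invariant under $\widetilde e_i^r$ for all $i\in I$ and $r\in\mathbb R$. Moreover $\mathscr C$ is a continuous crystal, $\mathscr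 B(\lambda)$ is a subcrystal of $\mathscr C$, and $\mathscr B(\lambda)=\mathscr F(\pi_\lambda)$. -/

import Mathlib

noncomputable section

/-- A generalized Cartan datum `(A, P^∨, P, Π^∨, Π)` with finite index set `I`: `A` is a symmetrizable
generalized Cartan matrix, the dual weight lattice `P^∨ = Pd` is a lattice of finite rank, the weight
lattice is `P = Hom_ℤ(P^∨, ℤ)`, and the simple coroots `h_i ∈ P^∨` and the simple roots `α_i ∈ P` are
linearly independent with `⟨α_j, h_i⟩ = a_{ij}`. -/
structure CartanDatum (I Pd : Type*) [Fintype I] [AddCommGroup Pd]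
    [Module.Free ℤ Pd] [Module.Finite ℤ Pd] where
  A : Matrix I I ℤ
  diag : ∀ i, A i i = 2
  offDiag_nonpos : ∀ i j, i ≠ j → A i j ≤ 0
  zero_iff : ∀ i j, A i j = 0 ↔ A j i = 0
  symmetrizable : ∃ d : I → ℚ, (∀ i, 0 < d i) ∧ ∀ i j, d i * A i j = d j * A j i
  /-- the simple coroots `h_i` -/
  coroot : I → Pd
  /-- the simple roots `α_i` -/
  root : I → Module.Dual ℤ Pd
  root_coroot : ∀ i j, root j (coroot i) = A i j
  coroot_indep : LinearIndependent ℤ coroot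
  root_indep : LinearIndependent ℤ root

/-- The data underlying a continuous crystal with weights in the real vector space `V`.
The formal symbol `𝟎` is `none`, and `-∞` is `⊥`. -/
structure CrystalData (I V B : Type*) where
  wt : B → V
  ε : I → B → WithBot ℝ
  φ : I → B → WithBot ℝ
  /-- the operators `ẽ_i^r` -/
  e : I → ℝ → B → Option B

namespace CrystalData

variable {I V B : Type*}

/-- `ẽ_i^r` extended to `B ∪ {𝟎}` by `ẽ_i^r 𝟎 = 𝟎`. -/
def eZero (X : CrystalData I V B) (i : I) (r : ℝ) (x : Option B) : Option B :=
  x.bind (X.e i r)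

/-- The subset `S ∪ {𝟎}` of `B ∪ {𝟎}`. -/
def withZero (S : Set B) : Set (Option B) := insert none (some '' S)

end CrystalData

namespace CartanDatum

variable {I Pd : Type*} [Fintype I] [AddCommGroup Pd] [Module.Free ℤ Pd] [Module.Finite ℤ Pd]

/-- `𝔥*_ℝ = ℝ ⊗_ℤ P`, realized as `Hom_ℤ(P^∨, ℝ)` (the same space, `P^∨` being free of finite rank).
The pairing `⟨μ, h⟩` is `μ h`. -/
abbrev RealWeight (_D : CartanDatum I Pd) : Type _ := Pd →ₗ[ℤ] ℝ

variable (D : CartanDatum I Pd)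

/-- The simple root `α_i` as an element of `𝔥*_ℝ`. -/
def realRoot (i : I) : D.RealWeight := (Int.castAddHom ℝ).toIntLinearMap ∘ₗ D.root i

/-- The linear form `μ ↦ ⟨μ, h_i⟩` on `𝔥*_ℝ`. -/
def corootForm (i : I) : Module.Dual ℝ D.RealWeight := LinearMap.applyₗ' ℝ (D.coroot i)

theorem corootForm_realRoot (i j : I) : D.corootForm i (D.realRoot j) = D.A i j := by
  simp [corootForm, realRoot, D.root_coroot, LinearMap.applyₗ']

theorem corootForm_realRoot_self (i : I) : D.corootForm i (D.realRoot i) = 2 := by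
  simp [corootForm_realRoot, D.diag]

/-- The simple reflection `s_i(μ) = μ - ⟨μ, h_i⟩ α_i`. -/
def simpleReflection (i : I) : D.RealWeight ≃ₗ[ℝ] D.RealWeight :=
  Module.reflection (D.corootForm_realRoot_self i)

/-- The Weyl group. -/
def weylGroup : Subgroup (D.RealWeight ≃ₗ[ℝ] D.RealWeight) :=
  Subgroup.closure (Set.range D.simpleReflection)

/-- The orbit `Wλ`. -/
def weylOrbit (lam : D.RealWeight) : Set D.RealWeight := {μ | ∃ w ∈ D.weylGroup, w lam = μ}

/-- The closed dominant chamber. -/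
def closedChamber : Set D.RealWeight := {lam | ∀ i, 0 ≤ D.corootForm i lam}

/-- `μ = s_β(ν)` and `⟨ν, h_β⟩ < 0` for some positive real root `β`. Real roots are the vectors
`β = w α_i` with `w ∈ W`; then `⟨ν, h_β⟩ = ⟨w⁻¹ ν, h_i⟩` and `s_β(ν) = ν - ⟨ν, h_β⟩ β`. -/
def Step (ν μ : D.RealWeight) : Prop :=
  ∃ w ∈ D.weylGroup, ∃ i : I,
    (∃ c : I → ℕ, w (D.realRoot i) = ∑ j, (c j : ℝ) • D.realRoot j) ∧
    D.corootForm i (w⁻¹ ν) < 0 ∧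
    μ = ν - D.corootForm i (w⁻¹ ν) • w (D.realRoot i)

/-- The order `ν ≥ μ`. -/
def Ge (ν μ : D.RealWeight) : Prop := Relation.ReflTransGen D.Step ν μ

/-- The strict order `ν > μ`. -/
def Gt (ν μ : D.RealWeight) : Prop := D.Ge ν μ ∧ ν ≠ μ

/-- The set `𝒞` of continuous paths `π : [0,1] → 𝔥*_ℝ` starting at the origin. Continuity for the
canonical topology of the finite-dimensional real vector space `𝔥*_ℝ = Hom_ℤ(P^∨, ℝ)` is continuity
of all the functions `t ↦ ⟨π(t), h⟩` with `h ∈ P^∨`. -/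
@[ext] structure Path where
  toFun : unitInterval → D.RealWeight
  continuous_apply : ∀ h : Pd, Continuous fun t => toFun t h
  zero_start : toFun 0 = 0

/-- `⟨π(t), h_i⟩` -/
def height (i : I) (π : D.Path) (t : unitInterval) : ℝ := D.corootForm i (π.toFun t)

/-- `m_i = inf_{t ∈ [0,1]} ⟨π(t), h_i⟩` -/
def minHeight (i : I) (π : D.Path) : ℝ := sInf (Set.range (D.height i π))

/-- `t ↦ min {-r, inf_{s ∈ [t,1]} ⟨π(s), h_i⟩ - m_i}` -/
def lowerCoeff (i : I) (r : ℝ) (π : D.Path) (t : unitInterval) : ℝ :=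
  min (-r) (sInf (D.height i π '' Set.Icc t 1) - D.minHeight i π)

/-- `t ↦ min {0, -r - m_i + inf_{s ∈ [0,t]} ⟨π(s), h_i⟩}` -/
def raiseCoeff (i : I) (r : ℝ) (π : D.Path) (t : unitInterval) : ℝ :=
  min 0 (-r - D.minHeight i π + sInf (D.height i π '' Set.Icc 0 t))

theorem continuous_height (i : I) (π : D.Path) : Continuous (D.height i π) :=
  π.continuous_apply (D.coroot i)

theorem height_zero (i : I) (π : D.Path) : D.height i π 0 = 0 := by
  simp [height, π.zero_start]

theorem continuous_sInf_Icc_one {f : unitInterval → ℝ} (hf : Continuous f) :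
    Continuous fun t => sInf (f '' Set.Icc t 1) := by
  have h : (fun t => sInf (f '' Set.Icc t 1)) =
      fun t => sInf ((fun s => f (max t s)) '' (Set.univ : Set unitInterval)) := by
    funext t
    congr 1
    ext y
    constructor
    · rintro ⟨s, hs, rfl⟩
      exact ⟨s, trivial, by simp [max_eq_right hs.1]⟩
    · rintro ⟨s, -, rfl⟩
      exact ⟨max t s, ⟨le_max_left _ _, unitInterval.le_one'⟩, rfl⟩
  rw [h]
  exact isCompact_univ.continuous_sInf (f := fun t s => f (max t s))
    (hf.comp (continuous_fst.max continuous_snd))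

theorem continuous_sInf_Icc_zero {f : unitInterval → ℝ} (hf : Continuous f) :
    Continuous fun t => sInf (f '' Set.Icc 0 t) := by
  have h : (fun t => sInf (f '' Set.Icc 0 t)) =
      fun t => sInf ((fun s => f (min t s)) '' (Set.univ : Set unitInterval)) := by
    funext t
    congr 1
    ext y
    constructor
    · rintro ⟨s, hs, rfl⟩
      exact ⟨s, trivial, by simp [min_eq_right hs.2]⟩
    · rintro ⟨s, -, rfl⟩
      exact ⟨min t s, ⟨unitInterval.nonneg', min_le_left _ _⟩, rfl⟩
  rw [h]
  exact isCompact_univ.continuous_sInf (f := fun t s => f (min t s))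
    (hf.comp (continuous_fst.min continuous_snd))

theorem continuous_lowerCoeff (i : I) (r : ℝ) (π : D.Path) : Continuous (D.lowerCoeff i r π) :=
  continuous_const.min ((continuous_sInf_Icc_one (D.continuous_height i π)).sub continuous_const)

theorem continuous_raiseCoeff (i : I) (r : ℝ) (π : D.Path) : Continuous (D.raiseCoeff i r π) :=
  continuous_const.min
    (continuous_const.add (continuous_sInf_Icc_zero (D.continuous_height i π)))

theorem lowerCoeff_zero (i : I) {r : ℝ} (hr : r ≤ 0) (π : D.Path) : D.lowerCoeff i r π 0 = 0 := by
  have h : Set.Icc (0 : unitInterval) 1 = Set.univ :=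
    Set.eq_univ_of_forall fun _ => ⟨unitInterval.nonneg', unitInterval.le_one'⟩
  simp [lowerCoeff, minHeight, h, hr]

theorem raiseCoeff_zero (i : I) {r : ℝ} {π : D.Path} (hr : r ≤ -D.minHeight i π) :
    D.raiseCoeff i r π 0 = 0 := by
  simp only [raiseCoeff, Set.Icc_self, Set.image_singleton, csInf_singleton, height_zero, add_zero]
  exact min_eq_left (by linarith)

/-- The path `t ↦ π(t) - c(t) α_i`. -/
def shift (i : I) (π : D.Path) (c : unitInterval → ℝ) (hc : Continuous c) (h0 : c 0 = 0) :
    D.Path where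
  toFun t := π.toFun t - c t • D.realRoot i
  continuous_apply h := by
    exact (π.continuous_apply h).sub (hc.mul continuous_const)
  zero_start := by simp [π.zero_start, h0]

open Classical in
/-- The operators `ẽ_i^r` on paths. -/
def pathE (i : I) (r : ℝ) (π : D.Path) : Option D.Path :=
  if h : -D.height i π 1 + D.minHeight i π ≤ r ∧ r ≤ 0 then
    some (D.shift i π (D.lowerCoeff i r π) (D.continuous_lowerCoeff i r π)
      (D.lowerCoeff_zero i h.2 π))
  else if h : 0 ≤ r ∧ r ≤ -D.minHeight i π then
    some (D.shift i π (D.raiseCoeff i r π) (D.continuous_raiseCoeff i r π)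
      (D.raiseCoeff_zero i h.2))
  else none

/-- `𝒞` with `wt(π) = π(1)`, `ε_i(π) = -m_i`, `φ_i(π) = ⟨wt(π), h_i⟩ + ε_i(π)` and `ẽ_i^r`. -/
def pathCrystal : CrystalData I D.RealWeight D.Path where
  wt π := π.toFun 1
  ε i π := ((-D.minHeight i π : ℝ) : WithBot ℝ)
  φ i π := ((D.height i π 1 - D.minHeight i π : ℝ) : WithBot ℝ)
  e := D.pathE

/-- The axioms of a continuous crystal. (The convention `ẽ_i^r 𝟎 = 𝟎` is built into `eZero`.) -/
structure IsContinuousCrystal {B : Type*} (X : CrystalData I D.RealWeight B) : Prop where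
  phi_eq : ∀ i b, X.φ i b = ((D.corootForm i (X.wt b) : ℝ) : WithBot ℝ) + X.ε i b
  eps_e : ∀ i r b b', X.e i r b = some b' → X.ε i b' = X.ε i b + ((-r : ℝ) : WithBot ℝ)
  phi_e : ∀ i r b b', X.e i r b = some b' → X.φ i b' = X.φ i b + ((r : ℝ) : WithBot ℝ)
  wt_e : ∀ i r b b', X.e i r b = some b' → X.wt b' = X.wt b + r • D.realRoot i
  e_zero : ∀ i b, X.e i 0 b = some b
  e_add : ∀ i r s b b', X.e i r b = some b' → X.e i (r + s) b = X.e i s b'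
  e_bot : ∀ i r b, r ≠ 0 → X.φ i b = ⊥ → X.e i r b = none

/-- `S` is a subcrystal of `X`: `X` is a continuous crystal, and the maps of `X` restrict to `S`
(that is, `ẽ_i^r S ⊆ S ∪ {𝟎}`) and make it a continuous crystal. -/
def IsSubcrystal {B : Type*} (X : CrystalData I D.RealWeight B) (S : Set B) : Prop :=
  D.IsContinuousCrystal X ∧
    ∃ Y : CrystalData I D.RealWeight S,
      (∀ b : S, Y.wt b = X.wt b) ∧ (∀ i, ∀ b : S, Y.ε i b = X.ε i b) ∧
      (∀ i, ∀ b : S, Y.φ i b = X.φ i b) ∧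
      (∀ i r, ∀ b : S, (Y.e i r b).map Subtype.val = X.e i r b) ∧
      D.IsContinuousCrystal Y

/-- A pair `(ν_1 > ⋯ > ν_s ; 0 = a_0 < ⋯ < a_s = 1)` with `ν_k ∈ Wλ` and `a_k` real.
The weight `ν_k` is `ν (k - 1)` here. -/
structure LSPair (lam : D.RealWeight) where
  s : ℕ
  ν : Fin s → D.RealWeight
  a : Fin (s + 1) → ℝ
  mem_orbit : ∀ k, ν k ∈ D.weylOrbit lam
  decreasing : ∀ j k, j < k → D.Gt (ν j) (ν k)
  a_zero : a 0 = 0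
  a_last : a (Fin.last s) = 1
  a_strictMono : StrictMono a

/-- `π` is the piecewise linear path of the pair: for `a_{i-1} ≤ t ≤ a_i`,
`π(t) = ∑_{k=1}^{i-1} (a_k - a_{k-1}) ν_k + (t - a_{i-1}) ν_i`. -/
def LSPair.Represents {D : CartanDatum I Pd} {lam : D.RealWeight} (p : D.LSPair lam)
    (π : D.Path) : Prop :=
  ∀ i : Fin p.s, ∀ t : unitInterval, p.a i.castSucc ≤ t → t ≤ p.a i.succ →
    π.toFun t = ∑ k ∈ Finset.univ.filter (· < i), (p.a k.succ - p.a k.castSucc) • p.ν k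
      + ((t : ℝ) - p.a i.castSucc) • p.ν i

/-- The set `𝓑(λ)`, its elements being regarded as paths. -/
def LSPaths (lam : D.RealWeight) : Set D.Path := {π | ∃ p : D.LSPair lam, p.Represents π}

/-- The path `π_λ(t) = tλ`. -/
def straightPath (lam : D.RealWeight) : D.Path where
  toFun t := (t : ℝ) • lam
  continuous_apply h := by
    exact continuous_subtype_val.mul continuous_const
  zero_start := by simp

/-- `f̃_{i_1}^{r_1} ⋯ f̃_{i_k}^{r_k} π` for the list of the `(i_j, r_j)`, where `f̃_i^r = ẽ_i^{-r}`. -/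
def applyF (l : List (I × NNReal)) (π : D.Path) : Option D.Path :=
  l.foldr (fun p x => D.pathCrystal.eZero p.1 (-(p.2 : ℝ)) x) (some π)

/-- The set `𝓕(π)` of the paths (elements different from `𝟎`) of the form
`f̃_{i_1}^{r_1} ⋯ f̃_{i_k}^{r_k} π` with `k ≥ 0`, `i_j ∈ I` and `r_j ≥ 0`. -/
def generatedPaths (π : D.Path) : Set D.Path := {η | ∃ l, D.applyF l π = some η}

end CartanDatum

end

open CoxeterSystem (alternatingWord alternatingWord_succ alternatingWord_succ')

/-! ### Simple reflections and words in the Weyl group. -/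

namespace CartanDatum

variable {I Pd : Type*} [Fintype I] [AddCommGroup Pd] [Module.Free ℤ Pd] [Module.Finite ℤ Pd]
  (D : CartanDatum I Pd)

/-! Fix i and put M(t) = inf_{[0,t]} ⟨π, h_i⟩. The operator ẽ_i^r leaves π − M α_i unchanged and
adds r to m_i (`pathE_spec`). These two data determine π (`path_eq_of_pitman`), because a function
is determined by its Pitman transform f − 2 inf_{[0,t]} f and its minimum. So ẽ_i^r is translation
of one real parameter inside a fixed interval, which gives the crystal axioms on all paths.

The set 𝓑(λ) consists of the piecewise linear paths whose directions lie in Wλ and descend weakly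
(`mem_LSPaths_iff`). For r ≥ 0, ẽ_i^r applies s_i to the parts of π on which M decreases below the
level r + m_i, and translates the rest. The directions still descend (`Descending.raise`) because
replacing ν by whichever of ν, s_i ν pairs non-negatively with h_i respects the order
(`Ge.chamberSide_mono`); this rests on every real root being positive or negative
(`isNonneg_or_isNonneg_neg`). The case r ≤ 0 follows by reversing time, t ↦ π(1 − t) − π(1), which
negates the directions and reverses their sequence.

For generation, suppose that π starts in direction ν with ⟨ν, h_i⟩ < 0. The maximal ẽ_i turns the
initial direction into s_i ν. Induction over the orbit (`weylOrbit_induction`) leads to the initial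
direction λ. Nothing lies strictly below a dominant λ, so the path is then π_λ, and undoing the
operators writes π as a product of f̃'s applied to π_λ. -/

theorem simpleReflection_apply (i : I) (μ : D.RealWeight) :
    D.simpleReflection i μ = μ - D.corootForm i μ • D.realRoot i :=
  Module.reflection_apply _ _

@[simp] theorem simpleReflection_simpleReflection (i : I) (μ : D.RealWeight) :
    D.simpleReflection i (D.simpleReflection i μ) = μ :=
  Module.involutive_reflection (D.corootForm_realRoot_self i) μ

@[simp] theorem simpleReflection_mul_self (i : I) :
    D.simpleReflection i * D.simpleReflection i = 1 := by
  ext1 μ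
  simp

theorem simpleReflection_inv (i : I) : (D.simpleReflection i)⁻¹ = D.simpleReflection i :=
  inv_eq_of_mul_eq_one_left (D.simpleReflection_mul_self i)

theorem simpleReflection_realRoot_self (i : I) :
    D.simpleReflection i (D.realRoot i) = -D.realRoot i := by
  rw [simpleReflection_apply, corootForm_realRoot_self]
  module

theorem corootForm_simpleReflection_self (i : I) (μ : D.RealWeight) :
    D.corootForm i (D.simpleReflection i μ) = -D.corootForm i μ := by
  rw [simpleReflection_apply, map_sub, map_smul, corootForm_realRoot_self, smul_eq_mul]
  ring

theorem simpleReflection_mem (i : I) : D.simpleReflection i ∈ D.weylGroup :=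
  Subgroup.subset_closure ⟨i, rfl⟩

/-- In coordinates on a ℤ-basis of P^∨ the roots are integer vectors, and independence of integer
vectors over ℤ persists over ℝ. -/
theorem linearIndependent_realRoot : LinearIndependent ℝ D.realRoot := by
  classical
  let b := Module.Free.chooseBasis ℤ Pd
  have h1 : LinearIndependent ℤ fun i => fun k => D.root i (b k) :=
    D.root_indep.map' (b.constr ℤ (M' := ℤ)).symm.toLinearMap (LinearEquiv.ker _)
  have h2 : LinearIndependent ℝ fun i => fun k => ((D.root i (b k) : ℤ) : ℝ) :=
    (linearIndependent_algebraMap_comp_iff (R := ℤ) (S := ℝ)).mpr h1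
  let f : D.RealWeight →ₗ[ℝ] (Module.Free.ChooseBasisIndex ℤ Pd → ℝ) :=
    { toFun := fun μ k => μ (b k)
      map_add' := fun _ _ => rfl
      map_smul' := fun _ _ => rfl }
  exact LinearIndependent.of_comp f h2

/-- The product of the simple reflections of a word. -/
noncomputable def word (l : List I) : D.RealWeight ≃ₗ[ℝ] D.RealWeight :=
  (l.map D.simpleReflection).prod

@[simp] theorem word_nil : D.word [] = 1 := rfl

theorem word_cons (i : I) (l : List I) : D.word (i :: l) = D.simpleReflection i * D.word l := by
  simp [word]

theorem word_append (l l' : List I) : D.word (l ++ l') = D.word l * D.word l' := by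
  simp [word]

theorem word_singleton (i : I) : D.word [i] = D.simpleReflection i := by
  simp [word]

theorem word_mem (l : List I) : D.word l ∈ D.weylGroup := by
  induction l with
  | nil => exact one_mem _
  | cons i l ih => rw [word_cons]; exact mul_mem (D.simpleReflection_mem i) ih

theorem word_reverse (l : List I) : D.word l.reverse = (D.word l)⁻¹ := by
  induction l with
  | nil => simp
  | cons i l ih =>
    rw [List.reverse_cons, word_append, ih, word_singleton, D.word_cons i l, mul_inv_rev,
      simpleReflection_inv]

theorem exists_word {w : D.RealWeight ≃ₗ[ℝ] D.RealWeight} (hw : w ∈ D.weylGroup) :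
    ∃ l, D.word l = w := by
  induction hw using Subgroup.closure_induction with
  | mem x hx => obtain ⟨i, rfl⟩ := hx; exact ⟨[i], D.word_singleton i⟩
  | one => exact ⟨[], rfl⟩
  | mul x y _ _ hx hy =>
    obtain ⟨l, rfl⟩ := hx
    obtain ⟨l', rfl⟩ := hy
    exact ⟨l ++ l', D.word_append l l'⟩
  | inv x _ hx =>
    obtain ⟨l, rfl⟩ := hx
    exact ⟨l.reverse, D.word_reverse l⟩

/-! ### Positivity of real roots. -/

/-- Non-negative integral linear combinations of the simple roots. -/
def IsNonneg (β : D.RealWeight) : Prop := ∃ c : I → ℕ, β = ∑ j, (c j : ℝ) • D.realRoot j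

variable {D}

theorem IsNonneg.add {β γ : D.RealWeight} (hβ : D.IsNonneg β) (hγ : D.IsNonneg γ) :
    D.IsNonneg (β + γ) := by
  obtain ⟨b, rfl⟩ := hβ
  obtain ⟨c, rfl⟩ := hγ
  exact ⟨b + c, by simp [add_smul, Finset.sum_add_distrib]⟩

theorem IsNonneg.smul {β : D.RealWeight} (hβ : D.IsNonneg β) (n : ℕ) :
    D.IsNonneg ((n : ℝ) • β) := by
  obtain ⟨b, rfl⟩ := hβ
  exact ⟨fun j => n * b j, by simp [Finset.smul_sum, mul_smul]⟩

variable (D)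

theorem isNonneg_realRoot (i : I) : D.IsNonneg (D.realRoot i) := by
  classical
  exact ⟨Pi.single i 1, by simp [Pi.single_apply]⟩

/-- A word of minimal length among the words with the same product. -/
def Reduced (l : List I) : Prop := ∀ l', D.word l' = D.word l → l.length ≤ l'.length

theorem exists_reduced {w : D.RealWeight ≃ₗ[ℝ] D.RealWeight} (hw : w ∈ D.weylGroup) :
    ∃ l, D.word l = w ∧ D.Reduced l := by
  classical
  have h : ∃ n, ∃ l, D.word l = w ∧ l.length = n := by
    obtain ⟨l, hl⟩ := D.exists_word hw
    exact ⟨_, l, hl, rfl⟩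
  obtain ⟨l, hl, hn⟩ := Nat.find_spec h
  refine ⟨l, hl, fun l' hl' => ?_⟩
  rw [hn]
  exact Nat.find_min' h ⟨l', hl'.trans hl, rfl⟩

variable {D}

theorem Reduced.of_append {l l' : List I} (h : D.Reduced (l ++ l')) :
    D.Reduced l ∧ D.Reduced l' := by
  constructor
  · intro m hm
    have := h (m ++ l') (by rw [word_append, word_append, hm])
    simpa using this
  · intro m hm
    have := h (l ++ m) (by rw [word_append, word_append, hm])
    simpa using this

variable (D)

/-- Coordinates of `⋯ s_i s_j α_i` (`k` reflections, the first one applied being `s_j`) in the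
basis `α_i, α_j`, for `a = -a_{ij}` and `b = -a_{ji}`. -/
def dihedralCoeff (a b : ℤ) : ℕ → ℤ × ℤ
  | 0 => (1, 0)
  | k + 1 =>
    if Even k then ((dihedralCoeff a b k).1, b * (dihedralCoeff a b k).1 - (dihedralCoeff a b k).2)
    else (a * (dihedralCoeff a b k).2 - (dihedralCoeff a b k).1, (dihedralCoeff a b k).2)

theorem word_alternatingWord_realRoot (i j : I) (k : ℕ) :
    D.word (alternatingWord i j k) (D.realRoot i) =
      ((dihedralCoeff (-D.A i j) (-D.A j i) k).1 : ℝ) • D.realRoot i +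
      ((dihedralCoeff (-D.A i j) (-D.A j i) k).2 : ℝ) • D.realRoot j := by
  induction k with
  | zero => simp [alternatingWord, dihedralCoeff]
  | succ k ih =>
    rw [alternatingWord_succ', word_cons, LinearEquiv.mul_apply, ih, dihedralCoeff]
    split_ifs <;>
    · simp only [simpleReflection_apply, map_add, map_smul, corootForm_realRoot, D.diag]
      push_cast
      module

/-- The last conjunct makes the induction work: the current root pairs non-negatively with the
simple coroot that is not used next. With 4 ≤ ab this forces a non-positive pairing with the other
one, so the next reflection increases its coefficient. -/
theorem dihedralCoeff_nonneg_of_four_le {a b : ℤ} (ha : 0 ≤ a) (hb : 0 ≤ b) (hab : 4 ≤ a * b)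
    (k : ℕ) : 0 ≤ (dihedralCoeff a b k).1 ∧ 0 ≤ (dihedralCoeff a b k).2 ∧
      if Even k then a * (dihedralCoeff a b k).2 ≤ 2 * (dihedralCoeff a b k).1
      else b * (dihedralCoeff a b k).1 ≤ 2 * (dihedralCoeff a b k).2 := by
  induction k with
  | zero => simp [dihedralCoeff]
  | succ k ih =>
    obtain ⟨hp, hq, h⟩ := ih
    rw [dihedralCoeff]
    by_cases hk : Even k
    · have hk' : ¬ Even (k + 1) := by simpa [Nat.even_add_one] using hk
      rw [if_pos hk] at h
      simp only [if_pos hk, if_neg hk']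
      set p := (dihedralCoeff a b k).1
      set q := (dihedralCoeff a b k).2
      have h1 : 2 * q ≤ b * p := by
        have h2 : 4 * q ≤ a * b * q := mul_le_mul_of_nonneg_right hab hq
        have h3 : b * (a * q) ≤ b * (2 * p) := mul_le_mul_of_nonneg_left h hb
        nlinarith
      refine ⟨hp, by linarith, by linarith⟩
    · have hk' : Even (k + 1) := by simpa [Nat.even_add_one] using hk
      rw [if_neg hk] at h
      simp only [if_neg hk, if_pos hk']
      set p := (dihedralCoeff a b k).1
      set q := (dihedralCoeff a b k).2
      have h1 : 2 * p ≤ a * q := by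
        have h2 : 4 * p ≤ a * b * p := mul_le_mul_of_nonneg_right hab hp
        have h3 : a * (b * p) ≤ a * (2 * q) := mul_le_mul_of_nonneg_left h ha
        nlinarith
      refine ⟨by linarith, hq, by linarith⟩

variable {D}

theorem simpleReflection_apply_sub {i j : I} {a : ℝ} (ha : (D.A i j : ℝ) = -a)
    (μ : D.RealWeight) (x y : ℝ) :
    D.simpleReflection i (μ - x • D.realRoot i - y • D.realRoot j) =
      μ - (D.corootForm i μ - x + a * y) • D.realRoot i - y • D.realRoot j := by
  simp only [simpleReflection_apply, map_sub, map_smul, corootForm_realRoot, D.diag, ha]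
  push_cast
  module

theorem simpleReflection_apply_sub' {i j : I} {a : ℝ} (ha : (D.A j i : ℝ) = -a)
    (μ : D.RealWeight) (x y : ℝ) :
    D.simpleReflection j (μ - x • D.realRoot i - y • D.realRoot j) =
      μ - x • D.realRoot i - (D.corootForm j μ - y + a * x) • D.realRoot j := by
  simp only [simpleReflection_apply, map_sub, map_smul, corootForm_realRoot, D.diag, ha]
  push_cast
  module

variable (D)

/-- In rank two, either the coordinates stay non-negative or a braid relation holds. -/
theorem dihedral_cases {i j : I} (hij : i ≠ j) :
    (∀ k, 0 ≤ (dihedralCoeff (-D.A i j) (-D.A j i) k).1 ∧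
      0 ≤ (dihedralCoeff (-D.A i j) (-D.A j i) k).2) ∨
    ∃ m, D.word (alternatingWord i j m) = D.word (alternatingWord j i m) ∧ 0 < m ∧
      ∀ k < m, 0 ≤ (dihedralCoeff (-D.A i j) (-D.A j i) k).1 ∧
        0 ≤ (dihedralCoeff (-D.A i j) (-D.A j i) k).2 := by
  obtain ⟨a, ha⟩ : ∃ a, a = -D.A i j := ⟨_, rfl⟩
  obtain ⟨b, hb⟩ : ∃ b, b = -D.A j i := ⟨_, rfl⟩
  have ha0 : 0 ≤ a := by have := D.offDiag_nonpos i j hij; omega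
  have hb0 : 0 ≤ b := by have := D.offDiag_nonpos j i hij.symm; omega
  have hz : a = 0 ↔ b = 0 := by have := D.zero_iff i j; omega
  have hA : (D.A i j : ℝ) = -(a : ℝ) := by rw [ha]; push_cast; ring
  have hB : (D.A j i : ℝ) = -(b : ℝ) := by rw [hb]; push_cast; ring
  have start : ∀ μ : D.RealWeight, μ = μ - (0 : ℝ) • D.realRoot i - (0 : ℝ) • D.realRoot j :=
    fun μ => by module
  rw [← ha, ← hb]
  by_cases h4 : 4 ≤ a * b
  · exact Or.inl fun k => ⟨(dihedralCoeff_nonneg_of_four_le ha0 hb0 h4 k).1,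
      (dihedralCoeff_nonneg_of_four_le ha0 hb0 h4 k).2.1⟩
  right
  have hcases : (a = 0 ∧ b = 0) ∨ (a = 1 ∧ b = 1) ∨ (a = 1 ∧ b = 2) ∨ (a = 2 ∧ b = 1) ∨
      (a = 1 ∧ b = 3) ∨ (a = 3 ∧ b = 1) := by
    by_cases h0 : a = 0
    · exact Or.inl ⟨h0, hz.1 h0⟩
    have ha1 : 1 ≤ a := by omega
    have hb1 : 1 ≤ b := by omega
    have ha3 : a ≤ 3 := by nlinarith
    have hb3 : b ≤ 3 := by nlinarith
    interval_cases a <;> interval_cases b <;> omega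
  clear ha hb ha0 hb0 hz h4
  have braid : ∀ m, (∀ μ, D.word (alternatingWord i j m) μ = D.word (alternatingWord j i m) μ) →
      D.word (alternatingWord i j m) = D.word (alternatingWord j i m) := fun m h => by
    ext1 μ; exact h μ
  rcases hcases with ⟨rfl, rfl⟩ | ⟨rfl, rfl⟩ | ⟨rfl, rfl⟩ | ⟨rfl, rfl⟩ | ⟨rfl, rfl⟩ | ⟨rfl, rfl⟩
  -- The braid lengths 2, 3, 4, 6 belong to ab = 0, 1, 2, 3.
  on_goal 1 => refine ⟨2, braid _ fun μ => ?_, by norm_num, fun k hk => ?_⟩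
  on_goal 3 => refine ⟨3, braid _ fun μ => ?_, by norm_num, fun k hk => ?_⟩
  on_goal 5 => refine ⟨4, braid _ fun μ => ?_, by norm_num, fun k hk => ?_⟩
  on_goal 7 => refine ⟨4, braid _ fun μ => ?_, by norm_num, fun k hk => ?_⟩
  on_goal 9 => refine ⟨6, braid _ fun μ => ?_, by norm_num, fun k hk => ?_⟩
  on_goal 11 => refine ⟨6, braid _ fun μ => ?_, by norm_num, fun k hk => ?_⟩
  all_goals first
    | (interval_cases k <;> decide)
    -- Both words act on vectors μ − x α_i − y α_j, beginning with x = y = 0, so the braid relation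
    -- becomes two scalar identities.
    | (rw [start μ]
       simp only [alternatingWord, List.concat_eq_append, List.nil_append, List.cons_append,
         word_cons, word_nil, LinearEquiv.mul_apply, LinearEquiv.coe_one, id_eq,
         simpleReflection_apply_sub hA, simpleReflection_apply_sub' hB]
       congr 2
       · congr 1
         push_cast
         ring
       · push_cast
         ring)

variable {D}

/-- Two equal adjacent letters would cancel, so the letters alternate; the induction removes the
last letter and swaps i and j. -/
theorem Reduced.eq_alternatingWord {l : List I} (hl : D.Reduced l) {i j : I}
    (hmem : ∀ x ∈ l, x = i ∨ x = j) (hlast : ∀ l', l ≠ l' ++ [i]) :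
    l = alternatingWord i j l.length := by
  induction l using List.reverseRecOn generalizing i j with
  | nil => rfl
  | append_singleton l x ih =>
    have hx : x = j := by
      rcases hmem x (by simp) with rfl | h
      · exact absurd rfl (hlast l)
      · exact h
    subst hx
    have h := ih hl.of_append.1 (i := x) (j := i)
      (fun y hy => (hmem y (by simp [hy])).symm) (by
        rintro l' rfl
        have := hl l' (by
          simp [word_append, word_cons])
        simp at this)
    rw [List.length_append, List.length_singleton, alternatingWord_succ, ← h,
      List.concat_eq_append]

theorem exists_append_alternatingWord {J : Type*} (i j : J) {m k : ℕ} (h : m ≤ k) :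
    ∃ l, alternatingWord i j k = l ++ alternatingWord i j m := by
  induction k, h using Nat.le_induction with
  | base => exact ⟨[], rfl⟩
  | succ k _ ih =>
    obtain ⟨l, hl⟩ := ih
    exact ⟨_ :: l, by rw [alternatingWord_succ', hl, List.cons_append]⟩

/-- The word alternates and ends in j. If it had m or more letters, the braid relation would rewrite
it to end in i, and right multiplication by s_i would shorten it. So only coefficients already known
to be non-negative occur. -/
theorem Reduced.dihedral {l : List I} (hl : D.Reduced l) {i j : I} (hij : i ≠ j)
    (hmem : ∀ x ∈ l, x = i ∨ x = j)
    (hlen : ∀ l', D.word l' = D.word l * D.simpleReflection i → l.length ≤ l'.length) :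
    ∃ p q : ℕ, D.word l (D.realRoot i) = (p : ℝ) • D.realRoot i + (q : ℝ) • D.realRoot j := by
  have hlast : ∀ l', l ≠ l' ++ [i] := by
    rintro l' rfl
    have := hlen l' (by simp [word_append, word_singleton, mul_assoc])
    simp at this
  have halt := hl.eq_alternatingWord hmem hlast
  have key : 0 ≤ (dihedralCoeff (-D.A i j) (-D.A j i) l.length).1 ∧
      0 ≤ (dihedralCoeff (-D.A i j) (-D.A j i) l.length).2 := by
    rcases D.dihedral_cases hij with h | ⟨m, hbraid, hm, h⟩
    · exact h _
    · refine h _ (lt_of_not_ge fun hml => ?_)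
      obtain ⟨l', hl'⟩ := exists_append_alternatingWord i j hml
      obtain ⟨m, rfl⟩ := Nat.exists_eq_succ_of_ne_zero hm.ne'
      have h1 : l.length = l'.length + (m + 1) := by
        have := congrArg List.length hl'
        simpa using this
      have h2 : D.word l = D.word (l' ++ alternatingWord i j m) * D.simpleReflection i := by
        rw [halt, hl', word_append, word_append, hbraid, Nat.succ_eq_add_one,
          alternatingWord_succ, List.concat_eq_append, word_append, word_singleton, mul_assoc]
      have := hlen (l' ++ alternatingWord i j m) (by rw [h2, mul_assoc]; simp)
      simp at this
      omega
  obtain ⟨hp, hq⟩ := key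
  refine ⟨(dihedralCoeff (-D.A i j) (-D.A j i) l.length).1.toNat,
    (dihedralCoeff (-D.A i j) (-D.A j i) l.length).2.toNat, ?_⟩
  have hcast : ∀ z : ℤ, 0 ≤ z → ((z.toNat : ℕ) : ℝ) = z := fun z hz => by
    rw [← Int.cast_natCast, Int.toNat_of_nonneg hz]
  rw [hcast _ hp, hcast _ hq, ← word_alternatingWord_realRoot, ← halt]

/-- If multiplication by `s_i` on the right does not shorten `w`, then `w α_i` is positive. -/
theorem Reduced.isNonneg {l : List I} (hl : D.Reduced l) (i : I)
    (hlen : ∀ l', D.word l' = D.word l * D.simpleReflection i → l.length ≤ l'.length) :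
    D.IsNonneg (D.word l (D.realRoot i)) := by
  classical
  induction hn : l.length using Nat.strong_induction_on generalizing l i with
  | _ n ih =>
  subst hn
  rcases List.eq_nil_or_concat' l with rfl | ⟨l₀, j, rfl⟩
  · simpa using D.isNonneg_realRoot i
  have hij : i ≠ j := by
    rintro rfl
    have := hlen l₀ (by simp [word_append, word_singleton, mul_assoc])
    simp at this
  set l := l₀ ++ [j] with hldef
  -- Factor the word as l₁ l₂ without changing its length, with l₂ in the letters i, j only and l₁
  -- as short as possible. Rank two treats l₂ α_i, and induction treats l₁ α_i and l₁ α_j.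
  have hex : ∃ n, ∃ l₁ l₂ : List I, D.word (l₁ ++ l₂) = D.word l ∧
      (l₁ ++ l₂).length = l.length ∧ (∀ x ∈ l₂, x = i ∨ x = j) ∧ l₁.length = n :=
    ⟨_, l₀, [j], rfl, rfl, by simp, rfl⟩
  obtain ⟨l₁, l₂, hw, hlen12, hmem, hn⟩ := Nat.find_spec hex
  have hmin := fun m => Nat.find_min' hex (m := m)
  have hlt : l₁.length < l.length := by
    have := hmin _ ⟨l₀, [j], rfl, rfl, by simp, rfl⟩
    rw [← hn] at this
    simp [hldef]
    omega
  rw [← hn] at hmin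
  have hred : D.Reduced (l₁ ++ l₂) := fun l' h' => by
    rw [hlen12]
    exact hl l' (h'.trans hw)
  have h1 : ∀ x, (x = i ∨ x = j) → D.IsNonneg (D.word l₁ (D.realRoot x)) := by
    intro x hx
    refine ih _ hlt hred.of_append.1 x (fun l' hl' => ?_) rfl
    -- If right multiplication by s_x shortened l₁, moving the letter x into l₂ would give a shorter
    -- first factor.
    by_contra hcon
    have hw' : D.word (l' ++ x :: l₂) = D.word l := by
      rw [word_append, word_cons, hl', ← hw, word_append, mul_assoc, ← mul_assoc _ _ (D.word l₂)]
      simp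
    have h2 := hl _ hw'
    simp only [List.length_append, List.length_cons] at h2 hlen12
    have h3 := hmin l'.length ⟨l', x :: l₂, hw', by simp; omega, by
      simpa using ⟨hx, hmem⟩, rfl⟩
    omega
  have h2 : ∀ l', D.word l' = D.word l₂ * D.simpleReflection i → l₂.length ≤ l'.length := by
    intro l' hl'
    have := hlen (l₁ ++ l') (by rw [word_append, hl', ← hw, word_append, mul_assoc])
    rw [← hlen12] at this
    simpa using this
  obtain ⟨p, q, hpq⟩ := hred.of_append.2.dihedral hij hmem h2
  rw [← hw, word_append, LinearEquiv.mul_apply, hpq, map_add, map_smul, map_smul]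
  exact ((h1 i (Or.inl rfl)).smul p).add ((h1 j (Or.inr rfl)).smul q)

/-- Every real root is positive or negative. -/
theorem isNonneg_or_isNonneg_neg {w : D.RealWeight ≃ₗ[ℝ] D.RealWeight} (hw : w ∈ D.weylGroup)
    (i : I) : D.IsNonneg (w (D.realRoot i)) ∨ D.IsNonneg (-w (D.realRoot i)) := by
  obtain ⟨l, rfl, hl⟩ := D.exists_reduced hw
  by_cases h : ∀ l', D.word l' = D.word l * D.simpleReflection i → l.length ≤ l'.length
  · exact Or.inl (hl.isNonneg i h)
  -- Now w s_i is shorter than w, so it sends α_i to a positive root, and that root is −w α_i.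
  · push Not at h
    obtain ⟨l₁, hl₁, hlt⟩ := h
    obtain ⟨l₂, hl₂, hred⟩ := D.exists_reduced (D.word_mem l₁)
    right
    have h2 := hred.isNonneg i (fun l' hl' => by
      rw [hl₂, hl₁, mul_assoc, simpleReflection_mul_self, mul_one] at hl'
      have h3 := hred l₁ hl₂.symm
      have h4 := hl l' hl'
      omega)
    rwa [hl₂, hl₁, LinearEquiv.mul_apply, simpleReflection_realRoot_self, map_neg] at h2

/-! ### Coroots of real roots and dominance. -/

/-- `w (∑ c_k α_k / d_k) = ∑ c'_k α_k / d_k` and `w (∑ c_k h_k) = ∑ c'_k h_k` with the same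
coefficients, if `d` symmetrizes the Cartan matrix. -/
theorem word_root_coroot {d : I → ℝ} (hd : ∀ i, 0 < d i)
    (hsymm : ∀ i j, d i * D.A i j = d j * D.A j i) (l : List I) (c : I → ℝ) :
    ∃ c' : I → ℝ,
      D.word l (∑ k, (c k / d k) • D.realRoot k) = ∑ k, (c' k / d k) • D.realRoot k ∧
      ∀ ν, ∑ k, c k * D.corootForm k ((D.word l)⁻¹ ν) = ∑ k, c' k * D.corootForm k ν := by
  classical
  induction l with
  | nil => exact ⟨c, by simp, by simp⟩
  | cons i l ih =>
    obtain ⟨c', h1, h2⟩ := ih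
    refine ⟨c' - Pi.single i (∑ k, c' k * D.A k i), ?_, fun ν => ?_⟩
    · rw [word_cons, LinearEquiv.mul_apply, h1, simpleReflection_apply, map_sum]
      simp only [Pi.sub_apply, sub_div, sub_smul, Finset.sum_sub_distrib, map_smul,
        corootForm_realRoot, smul_eq_mul]
      congr 1
      simp only [Pi.single_apply, ite_div, zero_div, ite_smul, zero_smul, Finset.sum_ite_eq',
        Finset.mem_univ, if_true, Finset.sum_div]
      congr 1
      refine Finset.sum_congr rfl fun k _ => ?_
      have := hsymm i k
      have hi := (hd i).ne'
      have hk := (hd k).ne'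
      field_simp
      linear_combination c' k * this
    · rw [word_cons, mul_inv_rev, simpleReflection_inv, LinearEquiv.mul_apply, h2]
      simp only [simpleReflection_apply, map_sub, map_smul, corootForm_realRoot, smul_eq_mul,
        Pi.sub_apply, sub_mul, mul_sub, Finset.sum_sub_distrib]
      congr 1
      simp only [Pi.single_apply, ite_mul, zero_mul, Finset.sum_ite_eq', Finset.mem_univ,
        if_true, Finset.sum_mul]
      exact Finset.sum_congr rfl fun k _ => by ring

/-- The coroot of the real root `w α_i` is a combination of simple coroots, the coefficients being
positive multiples of those of `w α_i`. -/
theorem exists_coroot_coeff {w : D.RealWeight ≃ₗ[ℝ] D.RealWeight} (hw : w ∈ D.weylGroup) (i : I)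
    {b : I → ℝ} (hb : w (D.realRoot i) = ∑ k, b k • D.realRoot k) :
    ∃ e : I → ℝ, (∀ k, 0 < e k) ∧
      ∀ ν, D.corootForm i (w⁻¹ ν) = ∑ k, b k * e k * D.corootForm k ν := by
  classical
  obtain ⟨d, hd, hsymm⟩ := D.symmetrizable
  have hd' : ∀ k, (0 : ℝ) < d k := fun k => by exact_mod_cast hd k
  obtain ⟨l, rfl⟩ := D.exists_word hw
  obtain ⟨c, h1, h2⟩ := word_root_coroot (D := D) (d := fun k => (d k : ℝ)) hd'
    (fun i j => by exact_mod_cast hsymm i j) l (Pi.single i (d i : ℝ))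
  have hsingle : ∀ k, (Pi.single i (d i : ℝ) : I → ℝ) k / d k = (Pi.single i 1 : I → ℝ) k := by
    intro k
    by_cases hk : k = i
    · subst hk
      simp [(hd' k).ne']
    · simp [hk]
  simp only [hsingle] at h1
  rw [Finset.sum_eq_single i (fun k _ hk => by simp [hk]) (by simp), Pi.single_eq_same, one_smul,
    hb] at h1
  have hcoef : ∀ k, b k = c k / d k := by
    have h3 := Fintype.linearIndependent_iff.1 D.linearIndependent_realRoot
      (fun k => b k - c k / d k) (by simp [sub_smul, h1])
    exact fun k => sub_eq_zero.1 (h3 k)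
  -- The vector d_i (α_i / d_i) corresponds to d_i h_i; comparing coefficients after applying w
  -- gives d_i h_β = ∑ b_k d_k h_k.
  refine ⟨fun k => d k / d i, fun k => div_pos (hd' k) (hd' i), fun ν => ?_⟩
  have h3 := h2 ν
  rw [Finset.sum_eq_single i (fun k _ hk => by simp [hk]) (by simp), Pi.single_eq_same] at h3
  have hi := (hd' i).ne'
  rw [← mul_right_inj' hi, h3, Finset.mul_sum]
  refine Finset.sum_congr rfl fun k _ => ?_
  have hk := (hd' k).ne'
  rw [hcoef]
  field_simp

theorem corootForm_nonneg_of_isNonneg {w : D.RealWeight ≃ₗ[ℝ] D.RealWeight}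
    (hw : w ∈ D.weylGroup) {i : I} (h : D.IsNonneg (w (D.realRoot i))) {lam : D.RealWeight}
    (hlam : lam ∈ D.closedChamber) : 0 ≤ D.corootForm i (w⁻¹ lam) := by
  obtain ⟨c, hc⟩ := h
  obtain ⟨e, he, h⟩ := exists_coroot_coeff hw i hc
  rw [h]
  exact Finset.sum_nonneg fun k _ =>
    mul_nonneg (mul_nonneg (Nat.cast_nonneg _) (he k).le) (hlam k)

/-! ### The order on the Weyl orbit. -/

theorem not_step_of_mem_closedChamber {lam : D.RealWeight} (hlam : lam ∈ D.closedChamber)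
    (μ : D.RealWeight) : ¬ D.Step lam μ := by
  rintro ⟨w, hw, i, h, hneg, -⟩
  exact (corootForm_nonneg_of_isNonneg hw h hlam).not_gt hneg

theorem eq_of_ge_of_mem_closedChamber {lam μ : D.RealWeight} (hlam : lam ∈ D.closedChamber)
    (h : D.Ge lam μ) : μ = lam := by
  rcases Relation.ReflTransGen.cases_head h with h | ⟨κ, h, -⟩
  · exact h.symm
  · exact absurd h (not_step_of_mem_closedChamber hlam κ)

/-- A positive root β not proportional to α_i has a positive coefficient at some k ≠ i. Applying s_i
does not change that coefficient, so s_i β cannot be negative. If β is proportional to α_i, then s_β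
= s_i. -/
theorem Step.simpleReflection {ν μ : D.RealWeight} (h : D.Step ν μ) (i : I) :
    μ = D.simpleReflection i ν ∨ D.Step (D.simpleReflection i ν) (D.simpleReflection i μ) := by
  classical
  obtain ⟨w, hw, j, ⟨c, hc⟩, hneg, rfl⟩ := h
  by_cases hk : ∃ k, k ≠ i ∧ c k ≠ 0
  · right
    have hsw : D.simpleReflection i * w ∈ D.weylGroup := mul_mem (D.simpleReflection_mem i) hw
    have hinv : ∀ ν, (D.simpleReflection i * w)⁻¹ (D.simpleReflection i ν) = w⁻¹ ν := by
      intro ν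
      rw [mul_inv_rev, simpleReflection_inv, LinearEquiv.mul_apply,
        simpleReflection_simpleReflection]
    refine ⟨D.simpleReflection i * w, hsw, j, ?_, by rwa [hinv], ?_⟩
    · rcases isNonneg_or_isNonneg_neg hsw j with h | ⟨c', hc'⟩
      · exact h
      · exfalso
        obtain ⟨k, hki, hck⟩ := hk
        rw [LinearEquiv.mul_apply, simpleReflection_apply, hc] at hc'
        have h0 := Fintype.linearIndependent_iff.1 D.linearIndependent_realRoot
          (fun x => (c x : ℝ) + c' x - (Pi.single i (D.corootForm i
            (∑ j, (c j : ℝ) • D.realRoot j)) : I → ℝ) x) (by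
            simp only [sub_smul, add_smul, Finset.sum_sub_distrib, Finset.sum_add_distrib]
            rw [← hc']
            simp only [Pi.single_apply, ite_smul, zero_smul, Finset.sum_ite_eq', Finset.mem_univ,
              if_true]
            abel) k
        simp only [Pi.single_eq_of_ne hki, sub_zero] at h0
        have : (0 : ℝ) < c k := by exact_mod_cast Nat.pos_of_ne_zero hck
        have : (0 : ℝ) ≤ c' k := Nat.cast_nonneg _
        linarith
    · rw [hinv, map_sub, map_smul, LinearEquiv.mul_apply]
  · left
    push Not at hk
    obtain ⟨e, he, hform⟩ := exists_coroot_coeff hw j hc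
    have hform' : ∀ ν, D.corootForm j (w⁻¹ ν) = c i * e i * D.corootForm i ν := fun ν => by
      rw [hform, Finset.sum_eq_single i (fun k _ hki => by simp [hk k hki]) (by simp)]
    have hc' : w (D.realRoot j) = (c i : ℝ) • D.realRoot i := by
      rw [hc, Finset.sum_eq_single i (fun k _ hki => by simp [hk k hki]) (by simp)]
    -- Pairing β = c_i α_i with its own coroot gives c_i² e_i = 1, hence s_β = s_i.
    have h2 := hform' (w (D.realRoot j))
    rw [← LinearEquiv.mul_apply, inv_mul_cancel, LinearEquiv.coe_one, id_eq,
      corootForm_realRoot_self, hc', map_smul, corootForm_realRoot_self, smul_eq_mul] at h2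
    rw [hform', hc', smul_smul, simpleReflection_apply]
    congr 2
    linear_combination -(D.corootForm i ν / 2) * h2

theorem step_simpleReflection {ν : D.RealWeight} {i : I} (h : D.corootForm i ν < 0) :
    D.Step ν (D.simpleReflection i ν) :=
  ⟨1, one_mem _, i, D.isNonneg_realRoot i, by simpa using h, by
    simp [simpleReflection_apply]⟩

open Classical in
/-- The element of `{ν, s_i ν}` whose pairing with `h_i` is non-negative. -/
noncomputable def chamberSide (i : I) (ν : D.RealWeight) : D.RealWeight :=
  if D.corootForm i ν < 0 then D.simpleReflection i ν else ν

theorem chamberSide_of_neg {i : I} {ν : D.RealWeight} (h : D.corootForm i ν < 0) :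
    chamberSide i ν = D.simpleReflection i ν := if_pos h

theorem chamberSide_of_nonneg {i : I} {ν : D.RealWeight} (h : 0 ≤ D.corootForm i ν) :
    chamberSide i ν = ν := if_neg h.not_gt

theorem ge_chamberSide (i : I) (ν : D.RealWeight) : D.Ge ν (chamberSide i ν) := by
  rcases lt_or_ge (D.corootForm i ν) 0 with h | h
  · rw [chamberSide_of_neg h]
    exact .single (step_simpleReflection h)
  · rw [chamberSide_of_nonneg h]
    exact .refl

/-- It suffices to treat one step. Either the step is s_i, and both ends have the same image, or s_i
carries it to another step; what remains is joined by steps along α_i. -/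
theorem Ge.chamberSide_mono {ν μ : D.RealWeight} (h : D.Ge ν μ) (i : I) :
    D.Ge (chamberSide i ν) (chamberSide i μ) := by
  refine Relation.ReflTransGen.lift' (p := D.Step) (chamberSide i) (fun ν μ h => ?_) _ _ h
  change D.Ge (chamberSide i ν) (chamberSide i μ)
  have hge : D.Ge μ (chamberSide i μ) := ge_chamberSide i μ
  rcases h.simpleReflection i with rfl | h'
  · rcases lt_trichotomy (D.corootForm i ν) 0 with hν | hν | hν
    · rw [chamberSide_of_neg hν, chamberSide_of_nonneg
        (by rw [corootForm_simpleReflection_self]; linarith)]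
      exact .refl
    · rw [simpleReflection_apply, hν, zero_smul, sub_zero]
      exact .refl
    · rw [chamberSide_of_nonneg hν.le, chamberSide_of_neg
        (by rw [corootForm_simpleReflection_self]; linarith), simpleReflection_simpleReflection]
      exact .refl
  · rcases lt_or_ge (D.corootForm i ν) 0 with hν | hν
    · rw [chamberSide_of_neg hν]
      rcases lt_or_ge (D.corootForm i μ) 0 with hμ | hμ
      · rw [chamberSide_of_neg hμ]
        exact .single h'
      · rw [chamberSide_of_nonneg hμ]
        refine .head h' ?_
        rcases hμ.eq_or_lt with hμ | hμ
        · rw [simpleReflection_apply, ← hμ, zero_smul, sub_zero]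
        · have := step_simpleReflection (ν := D.simpleReflection i μ) (i := i)
            (by rw [corootForm_simpleReflection_self]; linarith)
          rw [simpleReflection_simpleReflection] at this
          exact .single this
    · rw [chamberSide_of_nonneg hν]
      exact .head h hge

-- Take θ = 1 on every simple root: a step adds a positive multiple of a positive root. This
-- excludes cycles in the order.
variable (D) in
theorem exists_height_functional :
    ∃ θ : D.RealWeight →ₗ[ℝ] ℝ, ∀ ν μ, D.Step ν μ → θ ν < θ μ := by
  obtain ⟨θ, hθ⟩ : ∃ θ : D.RealWeight →ₗ[ℝ] ℝ, ∀ i, θ (D.realRoot i) = 1 := by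
    let b := Module.Basis.extend D.linearIndependent_realRoot.linearIndepOn_id
    refine ⟨b.constr ℝ fun _ => (1 : ℝ), fun i => ?_⟩
    have : D.realRoot i = b ⟨D.realRoot i, Module.Basis.subset_extend _ ⟨i, rfl⟩⟩ := by
      simp [b]
    rw [this, Module.Basis.constr_basis]
  refine ⟨θ, ?_⟩
  rintro ν μ ⟨w, hw, i, ⟨c, hc⟩, hneg, rfl⟩
  have h0 : w (D.realRoot i) ≠ 0 := fun h => by
    have h1 : D.realRoot i = 0 := by simpa using h
    have h2 := D.corootForm_realRoot_self i
    rw [h1, map_zero] at h2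
    norm_num at h2
  have hpos : 0 < θ (w (D.realRoot i)) := by
    rw [hc, map_sum]
    simp only [map_smul, hθ, smul_eq_mul, mul_one]
    refine lt_of_le_of_ne (Finset.sum_nonneg fun k _ => Nat.cast_nonneg _) fun h => h0 ?_
    rw [eq_comm, Finset.sum_eq_zero_iff_of_nonneg (fun k _ => Nat.cast_nonneg _)] at h
    rw [hc]
    exact Finset.sum_eq_zero fun k hk => by rw [h k hk, zero_smul]
  rw [map_sub, map_smul, smul_eq_mul]
  nlinarith

theorem le_of_ge {θ : D.RealWeight →ₗ[ℝ] ℝ} (hθ : ∀ ν μ, D.Step ν μ → θ ν < θ μ)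
    {ν μ : D.RealWeight} (h : D.Ge ν μ) : θ ν ≤ θ μ := by
  induction h with
  | refl => exact le_rfl
  | tail _ h ih => exact ih.trans (hθ _ _ h).le

theorem lt_of_gt {θ : D.RealWeight →ₗ[ℝ] ℝ} (hθ : ∀ ν μ, D.Step ν μ → θ ν < θ μ)
    {ν μ : D.RealWeight} (h : D.Gt ν μ) : θ ν < θ μ := by
  rcases Relation.ReflTransGen.cases_head h.1 with h' | ⟨κ, h1, h2⟩
  · exact absurd h' h.2
  · exact (hθ _ _ h1).trans_le (le_of_ge hθ h2)

theorem Step.mem_weylOrbit {lam ν μ : D.RealWeight} (hν : ν ∈ D.weylOrbit lam)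
    (h : D.Step ν μ) : μ ∈ D.weylOrbit lam := by
  obtain ⟨v, hv, rfl⟩ := hν
  obtain ⟨w, hw, i, -, -, rfl⟩ := h
  refine ⟨w * D.simpleReflection i * w⁻¹ * v,
    mul_mem (mul_mem (mul_mem hw (D.simpleReflection_mem i)) (inv_mem hw)) hv, ?_⟩
  simp only [LinearEquiv.mul_apply, simpleReflection_apply, map_sub, map_smul]
  rw [← LinearEquiv.mul_apply w, mul_inv_cancel, LinearEquiv.coe_one, id_eq]

theorem Ge.mem_weylOrbit {lam ν μ : D.RealWeight} (hν : ν ∈ D.weylOrbit lam)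
    (h : D.Ge ν μ) : μ ∈ D.weylOrbit lam := by
  induction h with
  | refl => exact hν
  | tail _ h ih => exact h.mem_weylOrbit ih

/-- Since s_β ν pairs with h_β oppositely to ν, the same β serves. This is what makes time reversal
of paths compatible with the order. -/
theorem Step.neg {ν μ : D.RealWeight} (h : D.Step ν μ) : D.Step (-μ) (-ν) := by
  obtain ⟨w, hw, i, hc, hneg, rfl⟩ := h
  have h1 : D.corootForm i (w⁻¹ (-(ν - D.corootForm i (w⁻¹ ν) • w (D.realRoot i)))) =
      D.corootForm i (w⁻¹ ν) := by
    rw [map_neg, map_sub, map_smul, ← LinearEquiv.mul_apply, inv_mul_cancel, LinearEquiv.coe_one,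
      id_eq, map_neg, map_sub, map_smul, corootForm_realRoot_self, smul_eq_mul]
    ring
  refine ⟨w, hw, i, hc, by rwa [h1], ?_⟩
  rw [h1]
  module

theorem Ge.neg {ν μ : D.RealWeight} (h : D.Ge ν μ) : D.Ge (-μ) (-ν) := by
  induction h with
  | refl => exact .refl
  | tail _ h ih => exact .head h.neg ih

/-- Induction over the orbit of a dominant weight, from the dominant weight outwards. -/
theorem weylOrbit_induction {lam : D.RealWeight} (hlam : lam ∈ D.closedChamber)
    {motive : D.RealWeight → Prop} (base : motive lam)
    (step : ∀ (i : I) (ν : D.RealWeight), D.corootForm i ν < 0 →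
      motive (D.simpleReflection i ν) → motive ν)
    {ν : D.RealWeight} (hν : ν ∈ D.weylOrbit lam) : motive ν := by
  obtain ⟨w, hw, rfl⟩ := hν
  obtain ⟨l, rfl, hl⟩ := D.exists_reduced hw
  clear hw
  induction l with
  | nil => simpa using base
  | cons i l ih =>
    have hred : D.Reduced l := (Reduced.of_append (l := [i]) hl).2
    have hred' : D.Reduced l.reverse := fun l' h' => by
      have := hred l'.reverse (by rw [word_reverse, h', word_reverse, inv_inv])
      simpa using this
    -- Write w for the product of l. As s_i w is not shorter than w, w⁻¹ α_i is positive, so ⟨wλ,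
    -- h_i⟩ ≥ 0. If this vanishes, s_i fixes wλ.
    have h1 : D.IsNonneg ((D.word l)⁻¹ (D.realRoot i)) := by
      rw [← word_reverse]
      refine hred'.isNonneg i fun l' h' => ?_
      have := hl l'.reverse (by
        rw [word_reverse, h', word_reverse, mul_inv_rev, inv_inv, simpleReflection_inv, word_cons])
      simp at this ⊢
      omega
    have h2 := corootForm_nonneg_of_isNonneg (inv_mem (D.word_mem l)) h1 hlam
    rw [inv_inv] at h2
    rw [word_cons, LinearEquiv.mul_apply]
    rcases h2.eq_or_lt with h2 | h2
    · rw [simpleReflection_apply, ← h2, zero_smul, sub_zero]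
      exact ih hred
    · refine step i _ ?_ ?_
      · rw [corootForm_simpleReflection_self]
        linarith
      · rw [simpleReflection_simpleReflection]
        exact ih hred

end CartanDatum

/-! ### Running minima and the Pitman transform. -/

/-- The running minimum `t ↦ inf_{[0,t]} f`. -/
noncomputable def runMin (f : unitInterval → ℝ) (t : unitInterval) : ℝ := sInf (f '' Set.Icc 0 t)

/-- The minimum over the tail `t ↦ inf_{[t,1]} f`. -/
noncomputable def tailMin (f : unitInterval → ℝ) (t : unitInterval) : ℝ := sInf (f '' Set.Icc t 1)

section RunMin

variable {f g : unitInterval → ℝ}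

theorem runMin_eq_of {t : unitInterval} {x : ℝ} (h : ∃ s ≤ t, f s = x) (h' : ∀ s ≤ t, x ≤ f s) :
    runMin f t = x := by
  obtain ⟨s, hs, rfl⟩ := h
  refine IsLeast.csInf_eq ⟨⟨s, ⟨unitInterval.nonneg', hs⟩, rfl⟩, ?_⟩
  rintro _ ⟨u, hu, rfl⟩
  exact h' u hu.2

theorem exists_eq_runMin (hf : Continuous f) (t : unitInterval) : ∃ s ≤ t, f s = runMin f t := by
  obtain ⟨s, hs, h⟩ := (isCompact_Icc (a := (0 : unitInterval)) (b := t)).exists_isMinOn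
    ⟨0, le_rfl, unitInterval.nonneg'⟩ hf.continuousOn
  exact ⟨s, hs.2, (runMin_eq_of ⟨s, hs.2, rfl⟩ fun u hu => h ⟨unitInterval.nonneg', hu⟩).symm⟩

theorem runMin_le (hf : Continuous f) {s t : unitInterval} (h : s ≤ t) : runMin f t ≤ f s :=
  csInf_le (isCompact_Icc.image hf).bddBelow ⟨s, ⟨unitInterval.nonneg', h⟩, rfl⟩

theorem le_runMin (hf : Continuous f) {t : unitInterval} {x : ℝ} (h : ∀ s ≤ t, x ≤ f s) :
    x ≤ runMin f t := by
  obtain ⟨s, hs, h'⟩ := exists_eq_runMin hf t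
  exact h' ▸ h s hs

theorem runMin_anti (hf : Continuous f) {s t : unitInterval} (h : s ≤ t) :
    runMin f t ≤ runMin f s :=
  le_runMin hf fun _ hu => runMin_le hf (hu.trans h)

theorem runMin_zero : runMin f 0 = f 0 := by
  simp [runMin]

theorem tailMin_eq_runMin_symm (f : unitInterval → ℝ) (t : unitInterval) :
    tailMin f t = runMin (fun s => f (unitInterval.symm s)) (unitInterval.symm t) := by
  have : Set.Icc t 1 = unitInterval.symm '' Set.Icc 0 (unitInterval.symm t) := by
    ext s
    constructor
    · intro hs
      exact ⟨unitInterval.symm s, ⟨unitInterval.nonneg', unitInterval.symm_le_symm.2 hs.1⟩,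
        unitInterval.symm_symm s⟩
    · rintro ⟨u, hu, rfl⟩
      exact ⟨unitInterval.le_symm_comm.1 hu.2, unitInterval.le_one'⟩
  rw [tailMin, this, Set.image_image, runMin]

theorem continuous_comp_symm (hf : Continuous f) : Continuous fun s => f (unitInterval.symm s) :=
  hf.comp unitInterval.continuous_symm

theorem tailMin_le (hf : Continuous f) {s t : unitInterval} (h : t ≤ s) : tailMin f t ≤ f s := by
  rw [tailMin_eq_runMin_symm]
  have := runMin_le (continuous_comp_symm hf) (unitInterval.symm_le_symm.2 h)
  rwa [unitInterval.symm_symm] at this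

theorem exists_eq_tailMin (hf : Continuous f) (t : unitInterval) :
    ∃ s, t ≤ s ∧ f s = tailMin f t := by
  rw [tailMin_eq_runMin_symm]
  obtain ⟨s, hs, h⟩ := exists_eq_runMin (continuous_comp_symm hf) (unitInterval.symm t)
  exact ⟨unitInterval.symm s, unitInterval.le_symm_comm.1 hs, h⟩

theorem tailMin_mono (hf : Continuous f) {s t : unitInterval} (h : s ≤ t) :
    tailMin f s ≤ tailMin f t := by
  obtain ⟨u, hu, h'⟩ := exists_eq_tailMin hf t
  exact h' ▸ tailMin_le hf (h.trans hu)

theorem tailMin_zero_eq (f : unitInterval → ℝ) : tailMin f 0 = runMin f 1 := rfl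

/-- The first time after `t` at which the level `x` is reached is a time at which the running
minimum is reached. -/
theorem exists_hit_runMin (hf : Continuous f) {t u : unitInterval} {x : ℝ} (htu : t ≤ u)
    (hx : x ≤ runMin f t) (hu : f u ≤ x) : ∃ s, t ≤ s ∧ s ≤ u ∧ f s = x ∧ runMin f s = x := by
  have ivt : ∀ v, t ≤ v → f v ≤ x → ∃ s ∈ Set.Icc t v, f s = x := fun v htv hv =>
    intermediate_value_Icc' htv hf.continuousOn ⟨hv, hx.trans (runMin_le hf le_rfl)⟩
  have hK : IsCompact (Set.Icc t u ∩ f ⁻¹' {x}) :=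
    isCompact_Icc.inter_right (isClosed_singleton.preimage hf)
  obtain ⟨s, ⟨hs, hsx⟩, hleast⟩ := hK.exists_isLeast (ivt u htu hu)
  refine ⟨s, hs.1, hs.2, hsx, runMin_eq_of ⟨s, le_rfl, hsx⟩ fun v hv => ?_⟩
  rcases le_total v t with h | h
  · exact hx.trans (runMin_le hf h)
  · by_contra! hlt
    obtain ⟨s', hs', hx'⟩ := ivt v h hlt.le
    have h1 : s ≤ s' := hleast ⟨⟨hs'.1, hs'.2.trans (hv.trans hs.2)⟩, hx'⟩
    have h2 : v = s := le_antisymm hv (h1.trans hs'.2)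
    rw [h2] at hlt
    exact hlt.ne hsx

theorem exists_hit_tailMin (hf : Continuous f) {t u : unitInterval} {x : ℝ} (hut : u ≤ t)
    (hx : x ≤ tailMin f t) (hu : f u ≤ x) : ∃ s, u ≤ s ∧ s ≤ t ∧ f s = x ∧ tailMin f s = x := by
  rw [tailMin_eq_runMin_symm] at hx
  obtain ⟨s, h1, h2, h3, h4⟩ := exists_hit_runMin (continuous_comp_symm hf)
    (u := unitInterval.symm u) (unitInterval.symm_le_symm.2 hut) hx (by simpa using hu)
  refine ⟨unitInterval.symm s, unitInterval.le_symm_comm.1 h2, unitInterval.symm_le_comm.1 h1,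
    h3, ?_⟩
  rw [tailMin_eq_runMin_symm, unitInterval.symm_symm, h4]

/-- A function is determined by its Pitman transform `f - 2 inf_{[0,t]} f` and its minimum. -/
theorem runMin_eq_runMin_of_pitman (hf : Continuous f) (hg : Continuous g)
    (h : ∀ t, f t - 2 * runMin f t = g t - 2 * runMin g t) (h1 : runMin f 1 = runMin g 1)
    (t : unitInterval) :
    runMin f t = runMin g t := by
  have H : ∀ f g : unitInterval → ℝ, Continuous f → Continuous g →
      (∀ t, f t - 2 * runMin f t = g t - 2 * runMin g t) → runMin f 1 = runMin g 1 →
      runMin g t ≤ runMin f t := by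
    intro f g hf hg h h1
    by_contra! hlt
    -- After t, g must still descend to its final minimum. When g first returns to x = `runMin g t`,
    -- its transform equals −x, whereas that of f is at least −`runMin f t` > −x.
    have h5 : runMin g 1 ≤ runMin f t := h1 ▸ runMin_anti hf unitInterval.le_one'
    obtain ⟨v, -, hv⟩ := exists_eq_runMin hg 1
    have hvt : t ≤ v := by
      by_contra! hvt
      have := runMin_le hg hvt.le
      rw [hv] at this
      linarith
    obtain ⟨s, hts, hsv, hs, hs'⟩ := exists_hit_runMin hg hvt le_rfl
      (hv ▸ runMin_anti hg unitInterval.le_one')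
    have h2 := h s
    have h3 := runMin_anti hf hts
    have h4 := runMin_le hf (le_refl s)
    rw [hs, hs'] at h2
    linarith
  exact le_antisymm (H g f hg hf (fun t => (h t).symm) h1.symm) (H f g hf hg h h1)

/-- The new running minimum is max(`runMin f`, c): the function is unchanged until f first reaches
c, and it stays at or above c from then on. -/
theorem runMin_raise (hf : Continuous f) (h0 : f 0 = 0) {c : ℝ} (hc : c ≤ 0) (t : unitInterval) :
    runMin (fun t => f t - 2 * min 0 (-c + runMin f t)) t =
      runMin f t - min 0 (-c + runMin f t) := by
  rcases le_or_gt c (runMin f t) with h | h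
  · rw [min_eq_left (by linarith : (0 : ℝ) ≤ -c + runMin f t), sub_zero]
    have h1 : ∀ s ≤ t, f s - 2 * min 0 (-c + runMin f s) = f s := fun s hs => by
      have := runMin_anti hf hs
      rw [min_eq_left (by linarith : (0 : ℝ) ≤ -c + runMin f s)]
      ring
    refine runMin_eq_of ?_ fun s hs => ?_
    · obtain ⟨s, hs, h2⟩ := exists_eq_runMin hf t
      exact ⟨s, hs, (h1 s hs).trans h2⟩
    · rw [h1 s hs]
      exact runMin_le hf hs
  · rw [min_eq_right (by linarith : -c + runMin f t ≤ 0)]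
    refine runMin_eq_of ?_ fun s hs => ?_
    · obtain ⟨u, hut, hu⟩ := exists_eq_runMin hf t
      obtain ⟨s, -, hsu, h1, h2⟩ := exists_hit_runMin hf (t := 0) (u := u) (x := c)
        unitInterval.nonneg' (by rw [runMin_zero, h0]; exact hc) (by rw [hu]; exact h.le)
      refine ⟨s, hsu.trans hut, ?_⟩
      rw [h1, h2]
      simp
    · have h1 := runMin_le hf (le_refl s)
      rcases min_cases 0 (-c + runMin f s) with ⟨h2, h3⟩ | ⟨h2, h3⟩ <;> rw [h2] <;> linarith

/-- Before f attains its global minimum m, the correction vanishes. Afterwards the new minimum over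
[0,t] is attained at a time s ≤ t at which f and its tail minimum both equal m + min(r, `tailMin f
t` − m). -/
theorem runMin_lower (hf : Continuous f) {r : ℝ} (hr : 0 ≤ r) (t : unitInterval) :
    runMin (fun t => f t - 2 * min r (tailMin f t - runMin f 1)) t =
      runMin f t - min r (tailMin f t - runMin f 1) := by
  have hm : ∀ t, runMin f 1 ≤ tailMin f t := fun t => tailMin_mono hf unitInterval.nonneg'
  have hmono : ∀ s ≤ t, min r (tailMin f s - runMin f 1) ≤ min r (tailMin f t - runMin f 1) :=
    fun s hs => min_le_min le_rfl (sub_le_sub_right (tailMin_mono hf hs) _)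
  have hnonneg : ∀ s, 0 ≤ min r (tailMin f s - runMin f 1) :=
    fun s => le_min hr (sub_nonneg.2 (hm s))
  obtain ⟨u, hut, hu⟩ := exists_eq_runMin hf t
  rcases (runMin_anti hf (unitInterval.le_one' (t := t))).eq_or_lt with h | h
  · refine runMin_eq_of ?_ fun s hs => ?_
    · obtain ⟨s, -, hst, h1, h2⟩ := exists_hit_tailMin hf hut
        (x := runMin f 1 + min r (tailMin f t - runMin f 1))
        (by linarith [min_le_right r (tailMin f t - runMin f 1)]) (by
          rw [hu, ← h]
          linarith [hnonneg t])
      refine ⟨s, hst, ?_⟩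
      rw [h1, h2, add_sub_cancel_left, min_eq_right (min_le_left _ _), ← h]
      ring
    · have h1 := tailMin_le hf (le_refl s)
      have h2 := min_le_right r (tailMin f s - runMin f 1)
      have h3 := hmono s hs
      linarith
  · have h1 : tailMin f t = runMin f 1 := by
      refine le_antisymm ?_ (hm t)
      obtain ⟨v, -, hv⟩ := exists_eq_runMin hf 1
      rw [← hv]
      refine tailMin_le hf (le_of_not_gt fun hvt => ?_)
      have := runMin_le hf hvt.le
      linarith
    have h2 : ∀ s ≤ t, min r (tailMin f s - runMin f 1) = 0 := fun s hs => by
      refine le_antisymm ?_ (hnonneg s)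
      refine (hmono s hs).trans ?_
      rw [h1, sub_self]
      exact min_le_right _ _
    rw [h2 t le_rfl]
    refine runMin_eq_of ⟨u, hut, ?_⟩ fun s hs => ?_
    · rw [h2 u hut, hu]
      ring
    · rw [h2 s hs]
      linarith [runMin_le hf hs]

end RunMin

/-! ### The path crystal and its axioms. -/

namespace CartanDatum

variable {I Pd : Type*} [Fintype I] [AddCommGroup Pd] [Module.Free ℤ Pd] [Module.Finite ℤ Pd]
  {D : CartanDatum I Pd}

theorem minHeight_eq (i : I) (π : D.Path) : D.minHeight i π = runMin (D.height i π) 1 := by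
  have h : Set.Icc (0 : unitInterval) 1 = Set.univ :=
    Set.eq_univ_of_forall fun _ => ⟨unitInterval.nonneg', unitInterval.le_one'⟩
  rw [minHeight, runMin, h, Set.image_univ]

theorem minHeight_nonpos (i : I) (π : D.Path) : D.minHeight i π ≤ 0 := by
  rw [minHeight_eq, ← D.height_zero i π]
  exact runMin_le (D.continuous_height i π) unitInterval.le_one'

theorem minHeight_le_height_one (i : I) (π : D.Path) : D.minHeight i π ≤ D.height i π 1 := by
  rw [minHeight_eq]
  exact runMin_le (D.continuous_height i π) le_rfl

theorem lowerCoeff_eq (i : I) (r : ℝ) (π : D.Path) (t : unitInterval) :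
    D.lowerCoeff i r π t =
      min (-r) (tailMin (D.height i π) t - runMin (D.height i π) 1) := by
  rw [← minHeight_eq]; rfl

theorem raiseCoeff_eq (i : I) (r : ℝ) (π : D.Path) (t : unitInterval) :
    D.raiseCoeff i r π t = min 0 (-(r + D.minHeight i π) + runMin (D.height i π) t) := by
  rw [neg_add, ← sub_eq_add_neg]; rfl

theorem height_shift (i : I) (π : D.Path) (c : unitInterval → ℝ) (hc : Continuous c)
    (h0 : c 0 = 0) (t : unitInterval) :
    D.height i (D.shift i π c hc h0) t = D.height i π t - 2 * c t := by
  simp only [height, shift, map_sub, map_smul, corootForm_realRoot_self, smul_eq_mul]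
  ring

/-- `ẽ_i^r` changes the minimum by `r` and leaves the Pitman transform invariant. -/
theorem pathE_spec {i : I} {r : ℝ} {π η : D.Path} (h : D.pathE i r π = some η) :
    (∀ t, η.toFun t - runMin (D.height i η) t • D.realRoot i =
      π.toFun t - runMin (D.height i π) t • D.realRoot i) ∧
    D.minHeight i η = D.minHeight i π + r := by
  have hf := D.continuous_height i π
  have hshift : ∀ c (hc : Continuous c) (h0 : c 0 = 0),
      (∀ t, runMin (fun t => D.height i π t - 2 * c t) t = runMin (D.height i π) t - c t) →
      c 1 = -r → η = D.shift i π c hc h0 →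
      (∀ t, η.toFun t - runMin (D.height i η) t • D.realRoot i =
        π.toFun t - runMin (D.height i π) t • D.realRoot i) ∧
      D.minHeight i η = D.minHeight i π + r := by
    rintro c hc h0 hmin h1 rfl
    have hh : D.height i (D.shift i π c hc h0) = fun t => D.height i π t - 2 * c t :=
      funext (D.height_shift i π c hc h0)
    refine ⟨fun t => ?_, ?_⟩
    · rw [hh, hmin]
      simp only [shift]
      module
    · rw [minHeight_eq, minHeight_eq, hh, hmin, h1]
      ring
  unfold pathE at h
  split_ifs at h with h1 h2
  · refine hshift _ (D.continuous_lowerCoeff i r π) (D.lowerCoeff_zero i h1.2 π) ?_ ?_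
      (Option.some.inj h).symm
    · simp only [lowerCoeff_eq]
      exact runMin_lower hf (by linarith [h1.2])
    · have h3 : tailMin (D.height i π) 1 = D.height i π 1 := by simp [tailMin]
      rw [lowerCoeff_eq, h3, ← minHeight_eq]
      exact min_eq_left (by linarith [h1.1])
  · refine hshift _ (D.continuous_raiseCoeff i r π) (D.raiseCoeff_zero i h2.2) ?_ ?_
      (Option.some.inj h).symm
    · simp only [raiseCoeff_eq]
      exact runMin_raise hf (D.height_zero i π) (by linarith [h2.2])
    · rw [raiseCoeff_eq, ← minHeight_eq, min_eq_right (by linarith [h2.1])]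
      ring

theorem exists_pathE_iff (i : I) (r : ℝ) (π : D.Path) :
    (∃ η, D.pathE i r π = some η) ↔
      -D.height i π 1 + D.minHeight i π ≤ r ∧ r ≤ -D.minHeight i π := by
  have h0 := minHeight_nonpos i π
  have h1 := minHeight_le_height_one i π
  unfold pathE
  split_ifs with h2 h3
  · simp only [Option.some.injEq, exists_eq', true_iff]
    exact ⟨h2.1, by linarith [h2.2]⟩
  · simp only [Option.some.injEq, exists_eq', true_iff]
    exact ⟨by linarith [h3.1], h3.2⟩
  · simp only [exists_false, false_iff, not_and]
    intro h4 h5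
    rcases le_total r 0 with h | h
    · exact h2 ⟨h4, h⟩
    · exact h3 ⟨h, h5⟩

/-- Since ⟨α_i, h_i⟩ = 2, pairing the hypothesis with h_i gives equality of Pitman transforms of the
heights. -/
theorem path_eq_of_pitman {i : I} {π η : D.Path}
    (h : ∀ t, η.toFun t - runMin (D.height i η) t • D.realRoot i =
      π.toFun t - runMin (D.height i π) t • D.realRoot i)
    (hm : D.minHeight i η = D.minHeight i π) : η = π := by
  have key := runMin_eq_runMin_of_pitman (D.continuous_height i η) (D.continuous_height i π)
    (fun t => by
      have := congrArg (D.corootForm i) (h t)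
      simp only [map_sub, map_smul, corootForm_realRoot_self, smul_eq_mul] at this
      simp only [height]
      linarith) (by rw [← minHeight_eq, ← minHeight_eq, hm])
  ext1
  funext t
  have := h t
  rwa [key, sub_left_inj] at this

theorem wt_pathE {i : I} {r : ℝ} {π η : D.Path} (h : D.pathE i r π = some η) :
    η.toFun 1 = π.toFun 1 + r • D.realRoot i := by
  obtain ⟨h1, h2⟩ := pathE_spec h
  have := h1 1
  rw [← minHeight_eq, ← minHeight_eq, h2, sub_eq_iff_eq_add] at this
  rw [this]
  module

theorem height_one_pathE {i : I} {r : ℝ} {π η : D.Path} (h : D.pathE i r π = some η) :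
    D.height i η 1 = D.height i π 1 + 2 * r := by
  rw [height, wt_pathE h, map_add, map_smul, corootForm_realRoot_self, height, smul_eq_mul]
  ring

theorem pathE_zero (i : I) (π : D.Path) : D.pathE i 0 π = some π := by
  obtain ⟨η, h⟩ := (exists_pathE_iff i 0 π).2
    ⟨by linarith [minHeight_le_height_one i π], by linarith [minHeight_nonpos i π]⟩
  obtain ⟨h1, h2⟩ := pathE_spec h
  rw [h, path_eq_of_pitman h1 (by rw [h2, add_zero])]

/-- Both sides are defined for the same parameters, and their values have the same transform and the
same minimum. -/
theorem pathE_add {i : I} {r : ℝ} (s : ℝ) {π η : D.Path} (h : D.pathE i r π = some η) :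
    D.pathE i (r + s) π = D.pathE i s η := by
  obtain ⟨h1, h2⟩ := pathE_spec h
  have h3 := height_one_pathE h
  have hiff : (∃ ξ, D.pathE i (r + s) π = some ξ) ↔ ∃ ξ, D.pathE i s η = some ξ := by
    rw [exists_pathE_iff, exists_pathE_iff, h2, h3]
    constructor <;> rintro ⟨h4, h5⟩ <;> constructor <;> linarith
  cases hξ : D.pathE i s η with
  | none =>
    rw [hξ] at hiff
    simp only [reduceCtorEq, exists_false, iff_false, not_exists] at hiff
    exact Option.eq_none_iff_forall_ne_some.2 hiff
  | some ξ =>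
    obtain ⟨ξ', hξ'⟩ := hiff.2 ⟨ξ, hξ⟩
    obtain ⟨h4, h5⟩ := pathE_spec hξ
    obtain ⟨h6, h7⟩ := pathE_spec hξ'
    rw [hξ', path_eq_of_pitman (i := i) (π := ξ) (η := ξ') (fun t => by rw [h4, h1, h6])
      (by rw [h7, h5, h2]; ring)]

variable (D) in
theorem isContinuousCrystal_pathCrystal : D.IsContinuousCrystal D.pathCrystal where
  phi_eq i π := by
    simp only [pathCrystal, ← WithBot.coe_add, ← sub_eq_add_neg]
    rfl
  eps_e i r π η h := by
    simp only [pathCrystal, ← WithBot.coe_add, (pathE_spec h).2]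
    congr 1
    ring
  phi_e i r π η h := by
    simp only [pathCrystal, ← WithBot.coe_add, (pathE_spec h).2, height_one_pathE h]
    congr 1
    ring
  wt_e i r π η h := wt_pathE h
  e_zero i π := pathE_zero i π
  e_add i r s π η h := pathE_add s h
  e_bot i r π _ h := absurd h WithBot.coe_ne_bot

/-! ### Paths with descending directions. -/

/-- `γ` is affine on `[a, b]` with direction `ν`. -/
def AffineOn (γ : unitInterval → D.RealWeight) (a b : unitInterval) (ν : D.RealWeight) : Prop :=
  ∀ t, a ≤ t → t ≤ b → γ t = γ a + ((t : ℝ) - a) • ν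

theorem AffineOn.rev {γ : unitInterval → D.RealWeight} {a b : unitInterval} {ν : D.RealWeight}
    (h : AffineOn γ a b ν) (hab : a ≤ b) (v : D.RealWeight) :
    AffineOn (fun t => γ (unitInterval.symm t) - v) (unitInterval.symm b) (unitInterval.symm a)
      (-ν) := by
  intro t h1 h2
  simp only [unitInterval.symm_symm]
  rw [h _ (unitInterval.le_symm_comm.1 h2) (unitInterval.symm_le_comm.1 h1), h b hab le_rfl,
    unitInterval.coe_symm_eq, unitInterval.coe_symm_eq]
  module

theorem AffineOn.corootForm {γ : unitInterval → D.RealWeight} {a b : unitInterval}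
    {ν : D.RealWeight} (h : AffineOn γ a b ν) (i : I) {t : unitInterval} (h1 : a ≤ t)
    (h2 : t ≤ b) :
    D.corootForm i (γ t) = D.corootForm i (γ a) + ((t : ℝ) - a) * D.corootForm i ν := by
  rw [h t h1 h2, map_add, map_smul, smul_eq_mul]

/-- `γ` is piecewise affine on `[a, b]`, with directions `ν₁ ≥ ⋯ ≥ ν_s` bounded by
`ν ≥ ν₁` and `ν_s ≥ ν'`. -/
inductive Descending (γ : unitInterval → D.RealWeight) (a : unitInterval) (ν : D.RealWeight) :
    unitInterval → D.RealWeight → Prop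
  | nil : Descending γ a ν a ν
  | snoc {b b' : unitInterval} {ν' ν'' : D.RealWeight} :
      Descending γ a ν b ν' → b ≤ b' → D.Ge ν' ν'' → AffineOn γ b b' ν'' →
      Descending γ a ν b' ν''

namespace Descending

variable {γ : unitInterval → D.RealWeight} {a b : unitInterval} {ν ν' : D.RealWeight}

theorem ge (h : Descending γ a ν b ν') : D.Ge ν ν' := by
  induction h with
  | nil => exact .refl
  | snoc _ _ h _ ih => exact ih.trans h

theorem weaken (h : Descending γ a ν b ν') {ν'' : D.RealWeight} (h' : D.Ge ν' ν'') :
    Descending γ a ν b ν'' :=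
  -- A piece of length zero is affine in every direction.
  h.snoc le_rfl h' fun t h1 h2 => by
    rw [le_antisymm h2 h1, sub_self, zero_smul, add_zero]

theorem cons {a₀ : unitInterval} {ν₀ : D.RealWeight} (h0 : a₀ ≤ a) (hν : D.Ge ν₀ ν)
    (haff : AffineOn γ a₀ a ν₀) (h : Descending γ a ν b ν') : Descending γ a₀ ν₀ b ν' := by
  induction h with
  | nil => exact (nil.snoc h0 .refl haff).weaken hν
  | snoc _ hb hge hγ ih => exact ih.snoc hb hge hγ

theorem rev (h : Descending γ a ν b ν') (v : D.RealWeight) :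
    Descending (fun t => γ (unitInterval.symm t) - v) (unitInterval.symm b) (-ν')
      (unitInterval.symm a) (-ν) := by
  induction h with
  | nil => exact nil
  | snoc _ hb hge hγ ih =>
    exact ih.cons (unitInterval.symm_le_symm.2 hb) hge.neg (hγ.rev hb v)

end Descending

/-! ### Raising preserves descent. -/

section Raise

variable {i : I} {γ γ' : unitInterval → D.RealWeight} {c : ℝ} {a b : unitInterval}
  {ν ν' κ : D.RealWeight}

theorem AffineOn.runMin_eq (hf : Continuous fun t => D.corootForm i (γ t))
    (h : AffineOn γ a b ν) {t : unitInterval} (h1 : a ≤ t) (h2 : t ≤ b) :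
    runMin (fun t => D.corootForm i (γ t)) t =
      min (runMin (fun t => D.corootForm i (γ t)) a) (D.corootForm i (γ t)) := by
  refine le_antisymm (le_min (runMin_anti hf h1) (runMin_le hf le_rfl))
    (le_runMin hf fun s hs => ?_)
  rcases le_total s a with hsa | hsa
  · exact (min_le_left _ _).trans (runMin_le hf hsa)
  · have e1 := h.corootForm i hsa (hs.trans h2)
    have e2 := h.corootForm i h1 h2
    have h3 := runMin_le hf (le_refl a)
    have h4 : (a : ℝ) ≤ s := hsa
    have h5 : (s : ℝ) ≤ t := hs
    rcases le_total 0 (D.corootForm i ν) with hp | hp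
    · refine (min_le_left _ _).trans (h3.trans ?_)
      rw [e1]
      nlinarith
    · refine (min_le_right _ _).trans ?_
      rw [e1, e2]
      nlinarith

/-- Where the correction is constant, the direction is kept; where it follows the height, as in
`AffineOn.of_runMin_eq`, the direction is reflected. -/
theorem AffineOn.of_runMin_const (hγ' : ∀ t, γ' t = γ t -
      (min c (runMin (fun t => D.corootForm i (γ t)) t) - c) • D.realRoot i)
    (h : AffineOn γ a b ν)
    (hN : ∀ t, a ≤ t → t ≤ b → min c (runMin (fun t => D.corootForm i (γ t)) t) =
      min c (runMin (fun t => D.corootForm i (γ t)) a)) : AffineOn γ' a b ν := by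
  intro t h1 h2
  rw [hγ', hγ', hN t h1 h2, h t h1 h2]
  module

theorem AffineOn.of_runMin_eq (hγ' : ∀ t, γ' t = γ t -
      (min c (runMin (fun t => D.corootForm i (γ t)) t) - c) • D.realRoot i)
    (h : AffineOn γ a b ν)
    (hN : ∀ t, a ≤ t → t ≤ b → min c (runMin (fun t => D.corootForm i (γ t)) t) =
      D.corootForm i (γ t)) : AffineOn γ' a b (D.simpleReflection i ν) := by
  intro t h1 h2
  rw [hγ', hγ', hN t h1 h2, hN a le_rfl (h1.trans h2), h.corootForm i h1 h2, h t h1 h2,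
    simpleReflection_apply]
  module

/-- Raising a path by reflecting it where its running minimum below the level `c` decreases
keeps the sequence of directions descending. -/
theorem Descending.raise (hf : Continuous fun t => D.corootForm i (γ t))
    (hγ' : ∀ t, γ' t = γ t -
      (min c (runMin (fun t => D.corootForm i (γ t)) t) - c) • D.realRoot i)
    (h : Descending γ a ν b ν') (hκ : D.Ge κ (chamberSide i ν))
    (hκ' : min c (runMin (fun t => D.corootForm i (γ t)) a) < D.corootForm i (γ a) → D.Ge κ ν) :
    ∃ κ', Descending γ' a κ b κ' ∧ D.Ge κ' (chamberSide i ν') ∧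
      (min c (runMin (fun t => D.corootForm i (γ t)) b) < D.corootForm i (γ b) →
        D.Ge κ' ν') := by
  induction h with
  | nil => exact ⟨κ, .nil, hκ, hκ'⟩
  | @snoc b b' ν' ν'' _ hb hge haff ih =>
    obtain ⟨κ', hdesc, h1, h2⟩ := ih
    have hside := h1.trans (hge.chamberSide_mono i)
    rcases hb.eq_or_lt with rfl | hlt
    · exact ⟨κ', hdesc, hside, fun h => (h2 h).trans hge⟩
    have hlt' : (b : ℝ) < b' := hlt
    have hN : ∀ t, b ≤ t → t ≤ b' → min c (runMin (fun t => D.corootForm i (γ t)) t) =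
        min (min c (runMin (fun t => D.corootForm i (γ t)) b)) (D.corootForm i (γ t)) :=
      fun t ht ht' => by rw [haff.runMin_eq hf ht ht', min_assoc]
    have hx : min c (runMin (fun t => D.corootForm i (γ t)) b) ≤ D.corootForm i (γ b) :=
      (min_le_right _ _).trans (runMin_le hf le_rfl)
    have hval := fun t (ht : b ≤ t) (ht' : t ≤ b') => haff.corootForm i ht ht'
    have hy := hval b' hb le_rfl
    obtain ⟨N, hNdef⟩ : ∃ N, N = min c (runMin (fun t => D.corootForm i (γ t)) b) := ⟨_, rfl⟩
    obtain ⟨p, hp⟩ : ∃ p, p = D.corootForm i ν'' := ⟨_, rfl⟩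
    rw [← hNdef] at hN hx h2
    simp only [← hp] at hval hy
    -- If the piece ends at height at least N, it never goes below N, so the correction is constant
    -- and the direction ν'' is kept.
    rcases le_or_gt N (D.corootForm i (γ b')) with hN' | hN'
    · have hconst : ∀ t, b ≤ t → t ≤ b' → min c (runMin (fun t => D.corootForm i (γ t)) t) = N := by
        intro t ht ht'
        rw [hN t ht ht', min_eq_left]
        have e := hval t ht ht'
        have ht1 : (b : ℝ) ≤ t := ht
        have ht2 : (t : ℝ) ≤ b' := ht'
        rcases le_total 0 p with hp0 | hp0 <;> nlinarith
      have hge' : D.Ge κ' ν'' := by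
        -- Starting exactly at height N, the piece cannot go down, so ν'' is its own `chamberSide`.
        rcases hx.eq_or_lt with hx | hx
        · have hp0 : 0 ≤ p := by
            by_contra! hp0
            nlinarith
          rwa [chamberSide_of_nonneg (hp ▸ hp0)] at hside
        · exact (h2 hx).trans hge
      exact ⟨ν'', hdesc.snoc hb hge' (haff.of_runMin_const hγ' fun t ht ht' => by
        rw [hconst t ht ht', hNdef]), ge_chamberSide i ν'', fun _ => .refl⟩
    · have hp0 : p < 0 := by
        by_contra! hp0
        nlinarith
      have hend : min c (runMin (fun t => D.corootForm i (γ t)) b') = D.corootForm i (γ b') := by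
        rw [hN b' hb le_rfl, min_eq_right hN'.le]
      rw [chamberSide_of_neg (hp ▸ hp0)] at hside ⊢
      refine ⟨D.simpleReflection i ν'', ?_, .refl, fun h => absurd hend h.ne⟩
      rcases hx.eq_or_lt with hx | hx
      · refine hdesc.snoc hb hside (haff.of_runMin_eq hγ' fun t ht ht' => ?_)
        rw [hN t ht ht', min_eq_right]
        have e := hval t ht ht'
        have ht1 : (b : ℝ) ≤ t := ht
        nlinarith
      -- The height starts above N and crosses it at time d = b + (N − x)/p. The direction is ν''
      -- before d and s_i ν'' after it.
      · obtain ⟨x, hxdef⟩ : ∃ x, x = D.corootForm i (γ b) := ⟨_, rfl⟩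
        have hq : p * ((N - x) / p) = N - x := mul_div_cancel₀ _ hp0.ne
        have hd0 : 0 < (N - x) / p := div_pos_of_neg_of_neg (by linarith) hp0
        have hd1 : (b : ℝ) + (N - x) / p ≤ b' := by
          by_contra! hcon
          nlinarith
        let d : unitInterval := ⟨b + (N - x) / p,
          by linarith [b.2.1], hd1.trans b'.2.2⟩
        have hdval : (d : ℝ) = b + (N - x) / p := rfl
        have hbd : b ≤ d := Subtype.coe_le_coe.1 (by rw [hdval]; linarith)
        have hdb : d ≤ b' := Subtype.coe_le_coe.1 hd1
        have hfd : D.corootForm i (γ d) = N := by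
          rw [hval d hbd hdb, ← hxdef, hdval]
          linarith
        have haff1 : AffineOn γ b d ν'' := fun t ht ht' => haff t ht (ht'.trans hdb)
        have haff2 : AffineOn γ d b' ν'' := fun t ht ht' => by
          rw [haff t (hbd.trans ht) ht', haff d hbd hdb]
          module
        have hvald : ∀ t, d ≤ t → t ≤ b' → D.corootForm i (γ t) = N + ((t : ℝ) - d) * p := by
          intro t ht ht'
          rw [haff2.corootForm i ht ht', hfd, hp]
        have hstep : D.Ge ν'' (D.simpleReflection i ν'') :=
          .single (step_simpleReflection (hp ▸ hp0))
        refine (hdesc.snoc hbd ((h2 hx).trans hge)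
          (haff1.of_runMin_const hγ' fun t ht ht' => ?_)).snoc hdb hstep
          (haff2.of_runMin_eq hγ' fun t ht ht' => ?_)
        · rw [hN t ht (ht'.trans hdb), ← hNdef, min_eq_left]
          rw [← hfd, hval d hbd hdb, hval t ht (ht'.trans hdb)]
          have ht1 : (t : ℝ) ≤ d := ht'
          nlinarith
        · rw [hN t (hbd.trans ht) ht', min_eq_right]
          rw [hvald t ht ht']
          have ht1 : (d : ℝ) ≤ t := ht
          nlinarith

end Raise

/-! ### Descending paths are the elements of 𝓑(λ). -/

theorem Gt.trans {ν μ κ : D.RealWeight} (h : D.Gt ν μ) (h' : D.Gt μ κ) : D.Gt ν κ := by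
  obtain ⟨θ, hθ⟩ := D.exists_height_functional
  refine ⟨Relation.ReflTransGen.trans h.1 h'.1, fun heq => ?_⟩
  have h1 := lt_of_gt hθ h
  have h2 := lt_of_gt hθ h'
  rw [heq] at h1
  exact h1.asymm h2

theorem LSPair.exists_descending {lam : D.RealWeight} (p : D.LSPair lam) {π : D.Path}
    (h : p.Represents π) :
    ∃ ν ∈ D.weylOrbit lam, ∃ ν', Descending π.toFun 0 ν 1 ν' := by
  obtain ⟨s, ν, a, horb, hdec, h0, h1, hmono⟩ := p
  cases s with
  | zero => exact absurd (h0.symm.trans h1) zero_ne_one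
  | succ n =>
    have hI : ∀ k, a k ∈ Set.Icc (0 : ℝ) 1 := fun k =>
      ⟨h0 ▸ hmono.monotone (Fin.zero_le k), h1 ▸ hmono.monotone (Fin.le_last k)⟩
    let a' : Fin (n + 1 + 1) → unitInterval := fun k => ⟨a k, hI k⟩
    have haff : ∀ k : Fin (n + 1), AffineOn π.toFun (a' k.castSucc) (a' k.succ) (ν k) := by
      intro k t ht ht'
      have e1 := h k t ht ht'
      have e2 := h k (a' k.castSucc) le_rfl (ht.trans ht')
      rw [e1, e2]
      simp [a']
    have key : ∀ k : Fin (n + 1), Descending π.toFun 0 (ν 0) (a' k.succ) (ν k) := by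
      intro k
      induction k using Fin.induction with
      | zero =>
        have h00 : a' (Fin.castSucc 0) = 0 := Subtype.ext h0
        have := haff 0
        rw [h00] at this
        exact Descending.nil.snoc unitInterval.nonneg' .refl this
      | succ k ih =>
        refine ih.snoc (hmono.monotone ?_) (hdec _ _ k.castSucc_lt_succ).1 (haff k.succ)
        exact (Fin.castSucc_lt_succ (i := k.succ)).le
    refine ⟨ν 0, horb 0, ν (Fin.last n), ?_⟩
    have h11 : a' (Fin.last n).succ = 1 := Subtype.ext h1
    rw [← h11]
    exact key _

/-- Merging equal and dropping trivial pieces of a descending path. -/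
theorem Descending.exists_strict {γ : unitInterval → D.RealWeight} {b : unitInterval}
    {ν ν' : D.RealWeight} (h : Descending γ 0 ν b ν') :
    ∃ (n : ℕ) (d : ℕ → D.RealWeight) (a : ℕ → unitInterval), a 0 = 0 ∧ a n = b ∧
      (∀ k < n, a k < a (k + 1)) ∧ (∀ k < n, AffineOn γ (a k) (a (k + 1)) (d k)) ∧
      (∀ k, k + 1 < n → D.Gt (d k) (d (k + 1))) ∧ (∀ k < n, D.Ge ν (d k)) ∧
      ∀ k, k + 1 = n → D.Ge (d k) ν' := by
  induction h with
  | nil => exact ⟨0, fun _ => ν, fun _ => 0, rfl, rfl, by simp, by simp, by simp, by simp, by simp⟩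
  | @snoc b b' ν' ν'' hdesc hb hge haff ih =>
    have hν := hdesc.ge.trans hge
    obtain ⟨n, d, a, h0, hn, hlt, hγ, hgt, hd, hlast⟩ := ih
    rcases hb.eq_or_lt with rfl | hb'
    · exact ⟨n, d, a, h0, hn, hlt, hγ, hgt, hd, fun k hk => (hlast k hk).trans hge⟩
    -- If the last piece already has direction ν'', its right endpoint is moved to b'; otherwise a
    -- new piece is appended.
    by_cases hmerge : ∃ k, k + 1 = n ∧ d k = ν''
    · obtain ⟨m, rfl, hm⟩ := hmerge
      have hne : ∀ k < m + 1, k ≠ m + 1 := fun k hk => hk.ne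
      refine ⟨m + 1, d, Function.update a (m + 1) b', by simpa using h0, by simp, ?_, ?_,
        hgt, hd, ?_⟩
      · intro k hk
        rw [Function.update_of_ne (hne k hk)]
        rcases eq_or_ne k m with rfl | hkm
        · rw [Function.update_self]
          exact (hlt k hk).trans (hn ▸ hb')
        · rw [Function.update_of_ne (by omega)]
          exact hlt k hk
      · intro k hk
        rw [Function.update_of_ne (hne k hk)]
        rcases eq_or_ne k m with rfl | hkm
        · rw [Function.update_self]
          intro t ht ht'
          rcases le_total t b with htb | htb
          · exact hγ k hk t ht (htb.trans hn.ge)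
          · rw [haff t htb ht', ← hn, hγ k hk _ (hlt k hk).le le_rfl, hm]
            module
        · rw [Function.update_of_ne (by omega)]
          exact hγ k hk
      · intro k hk
        obtain rfl : k = m := by omega
        exact hm ▸ .refl
    · refine ⟨n + 1, Function.update d n ν'', Function.update a (n + 1) b', by simpa using h0,
        by simp, ?_, ?_, ?_, ?_, ?_⟩
      · intro k hk
        rw [Function.update_of_ne (by omega)]
        rcases eq_or_ne k n with rfl | hkn
        · rw [Function.update_self, hn]
          exact hb'
        · rw [Function.update_of_ne (by omega)]
          exact hlt k (by omega)
      · intro k hk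
        rw [Function.update_of_ne (by omega)]
        rcases eq_or_ne k n with rfl | hkn
        · rw [Function.update_self, Function.update_self, hn]
          exact haff
        · rw [Function.update_of_ne (by omega), Function.update_of_ne hkn]
          exact hγ k (by omega)
      · intro k hk
        rw [Function.update_of_ne (by omega)]
        rcases eq_or_ne (k + 1) n with hkn | hkn
        · rw [hkn, Function.update_self]
          exact ⟨(hlast k hkn).trans hge, fun h => hmerge ⟨k, hkn, h⟩⟩
        · rw [Function.update_of_ne hkn]
          exact hgt k (by omega)
      · intro k hk
        rcases eq_or_ne k n with rfl | hkn
        · rw [Function.update_self]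
          exact hν
        · rw [Function.update_of_ne hkn]
          exact hd k (by omega)
      · intro k hk
        obtain rfl : k = n := by omega
        rw [Function.update_self]
        exact .refl

theorem Descending.mem_LSPaths {lam ν ν' : D.RealWeight} {π : D.Path}
    (hν : ν ∈ D.weylOrbit lam) (h : Descending π.toFun 0 ν 1 ν') : π ∈ D.LSPaths lam := by
  obtain ⟨n, d, a, h0, hn, hlt, hγ, hgt, hd, -⟩ := h.exists_strict
  have hgt' : ∀ j k, j < k → k < n → D.Gt (d j) (d k) := by
    intro j k hjk
    induction k, hjk using Nat.le_induction with
    | base => exact fun hk => hgt j hk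
    | succ k _ ih => exact fun hk => (ih (by omega)).trans (hgt k hk)
  refine ⟨⟨n, fun k => d k, fun k => a k, fun k => (hd k k.2).mem_weylOrbit hν,
    fun j k hjk => hgt' j k hjk k.2, by simp [h0], by simp [hn],
    Fin.strictMono_iff_lt_succ.2 fun k => hlt k k.2⟩, ?_⟩
  have hsum : ∀ m ≤ n, π.toFun (a m) =
      ∑ k ∈ Finset.range m, ((a (k + 1) : ℝ) - a k) • d k := by
    intro m
    induction m with
    | zero => simp [h0, π.zero_start]
    | succ m ih =>
      intro hm
      rw [Finset.sum_range_succ, ← ih (by omega)]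
      exact hγ m hm _ (hlt m hm).le le_rfl
  intro i t ht ht'
  have e := hγ i i.2 t ht ht'
  rw [hsum i i.2.le] at e
  rw [e]
  congr 1
  rw [← Nat.Iio_eq_range, ← Fin.map_valEmbedding_Iio, Finset.sum_map]
  refine Finset.sum_congr ?_ fun k _ => by simp
  ext k
  simp

theorem mem_LSPaths_iff {lam : D.RealWeight} {π : D.Path} :
    π ∈ D.LSPaths lam ↔ ∃ ν ∈ D.weylOrbit lam, ∃ ν', Descending π.toFun 0 ν 1 ν' :=
  ⟨fun ⟨p, h⟩ => p.exists_descending h, fun ⟨_, hν, _, h⟩ => h.mem_LSPaths hν⟩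

/-! ### Time reversal and invariance of 𝓑(λ). -/

variable (D) in
/-- The reversed path `t ↦ π(1 - t) - π(1)`. -/
def revPath (π : D.Path) : D.Path where
  toFun t := π.toFun (unitInterval.symm t) - π.toFun 1
  continuous_apply h := by
    exact ((π.continuous_apply h).comp unitInterval.continuous_symm).sub continuous_const
  zero_start := by simp

theorem revPath_revPath (π : D.Path) : D.revPath (D.revPath π) = π := by
  ext1
  funext t
  simp [revPath, π.zero_start]

theorem Descending.revPath {π : D.Path} {ν ν' : D.RealWeight}
    (h : Descending π.toFun 0 ν 1 ν') : Descending (D.revPath π).toFun 0 (-ν') 1 (-ν) := by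
  have := h.rev (π.toFun 1)
  rwa [unitInterval.symm_one, unitInterval.symm_zero] at this

theorem runMin_sub_const {f : unitInterval → ℝ} (hf : Continuous f) (x : ℝ) (t : unitInterval) :
    runMin (fun s => f s - x) t = runMin f t - x := by
  obtain ⟨s, hs, h⟩ := exists_eq_runMin hf t
  exact runMin_eq_of ⟨s, hs, by rw [h]⟩ fun s hs => sub_le_sub_right (runMin_le hf hs) x

theorem runMin_height_revPath (i : I) (π : D.Path) (t : unitInterval) :
    runMin (D.height i (D.revPath π)) t =
      tailMin (D.height i π) (unitInterval.symm t) - D.height i π 1 := by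
  have h : D.height i (D.revPath π) =
      fun s => D.height i π (unitInterval.symm s) - D.height i π 1 := by
    funext s
    simp [height, CartanDatum.revPath]
  rw [h, runMin_sub_const (continuous_comp_symm (D.continuous_height i π)),
    tailMin_eq_runMin_symm, unitInterval.symm_symm]

theorem toFun_pathE_of_nonneg {i : I} {r : ℝ} {π η : D.Path} (h : D.pathE i r π = some η)
    (hr : 0 ≤ r) (t : unitInterval) :
    η.toFun t = π.toFun t - D.raiseCoeff i r π t • D.realRoot i := by
  rcases hr.eq_or_lt with rfl | hr
  -- At r = 0 the definition takes the lowering branch, so the raising formula needs its own check.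
  · rw [pathE_zero, Option.some.injEq] at h
    subst h
    have := runMin_anti (D.continuous_height i π) (unitInterval.le_one' (t := t))
    rw [raiseCoeff_eq, minHeight_eq, min_eq_left (by linarith), zero_smul, sub_zero]
  · unfold pathE at h
    rw [dif_neg (fun h => h.2.not_gt hr)] at h
    split_ifs at h
    rw [← Option.some.inj h]
    rfl

theorem toFun_pathE_of_nonpos {i : I} {r : ℝ} {π η : D.Path} (h : D.pathE i r π = some η)
    (hr : r ≤ 0) (t : unitInterval) :
    η.toFun t = π.toFun t - D.lowerCoeff i r π t • D.realRoot i := by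
  have h1 := (exists_pathE_iff i r π).1 ⟨η, h⟩
  unfold pathE at h
  rw [dif_pos ⟨h1.1, hr⟩] at h
  rw [← Option.some.inj h]
  rfl

/-- The level is c = r + m_i ≤ 0 and the path starts at height 0. For the maximal r, c = 0 and only
the bound by `chamberSide i ν` is needed, so the new path may start in direction s_i ν. -/
theorem Descending.pathE_of_nonneg {i : I} {r : ℝ} {π η : D.Path} {ν ν' κ : D.RealWeight}
    (h : Descending π.toFun 0 ν 1 ν') (hη : ∀ t, η.toFun t =
      π.toFun t - D.raiseCoeff i r π t • D.realRoot i)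
    (hr : r ≤ -D.minHeight i π) (hκ : D.Ge κ (chamberSide i ν))
    (hκ' : r < -D.minHeight i π → D.Ge κ ν) : ∃ κ', Descending η.toFun 0 κ 1 κ' := by
  have hz : D.corootForm i (π.toFun 0) = 0 := D.height_zero i π
  obtain ⟨κ', h', -⟩ := h.raise (γ' := η.toFun) (c := r + D.minHeight i π)
    (D.continuous_height i π) (fun t => by
      rw [hη, raiseCoeff_eq, ← min_sub_sub_right, sub_self, neg_add_eq_sub]
      rfl) hκ (fun hlt => hκ' (by
        rw [runMin_zero, hz, min_eq_left (by linarith)] at hlt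
        linarith))
  exact ⟨κ', h'⟩

theorem neg_mem_weylOrbit_neg {lam μ : D.RealWeight} (h : μ ∈ D.weylOrbit lam) :
    -μ ∈ D.weylOrbit (-lam) := by
  obtain ⟨w, hw, rfl⟩ := h
  exact ⟨w, hw, map_neg w lam⟩

theorem Ge.mem_weylOrbit_left {lam ν μ : D.RealWeight} (h : D.Ge ν μ)
    (hμ : μ ∈ D.weylOrbit lam) : ν ∈ D.weylOrbit lam := by
  have := neg_mem_weylOrbit_neg (h.neg.mem_weylOrbit (neg_mem_weylOrbit_neg hμ))
  rwa [neg_neg, neg_neg] at this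

theorem mem_LSPaths_of_pathE {lam : D.RealWeight} {i : I} {r : ℝ} {π η : D.Path}
    (hπ : π ∈ D.LSPaths lam) (h : D.pathE i r π = some η) : η ∈ D.LSPaths lam := by
  obtain ⟨ν, hν, ν', hdesc⟩ := mem_LSPaths_iff.1 hπ
  have hdom := (exists_pathE_iff i r π).1 ⟨η, h⟩
  rcases le_total 0 r with hr | hr
  · obtain ⟨κ', h'⟩ := hdesc.pathE_of_nonneg (toFun_pathE_of_nonneg h hr) hdom.2
      (ge_chamberSide i ν) (fun _ => .refl)
    exact h'.mem_LSPaths hν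
  · have hmin : D.minHeight i (D.revPath π) = D.minHeight i π - D.height i π 1 := by
      rw [minHeight_eq, runMin_height_revPath, unitInterval.symm_one, tailMin_zero_eq,
        ← minHeight_eq]
    obtain ⟨κ', h'⟩ := hdesc.revPath.pathE_of_nonneg (i := i) (r := -r) (η := D.revPath η)
      (fun t => by
        -- Reversal turns ẽ_i^r into ẽ_i^{−r}. The two corrections differ by the constant r, which
        -- is absorbed by η(1) = π(1) + r α_i.
        have h1 : D.raiseCoeff i (-r) (D.revPath π) t =
            D.lowerCoeff i r π (unitInterval.symm t) + r := by
          rw [raiseCoeff_eq, hmin, runMin_height_revPath, lowerCoeff_eq, ← minHeight_eq,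
            ← min_add_add_right]
          congr 1 <;> ring
        rw [h1]
        simp only [revPath]
        rw [toFun_pathE_of_nonpos h hr, wt_pathE h]
        module)
      (by rw [hmin]; linarith [hdom.1]) (ge_chamberSide i _) (fun _ => .refl)
    have h2 := h'.revPath
    rw [revPath_revPath, neg_neg] at h2
    -- Reversal controls the final bound ν'; membership in the orbit passes up the order to the
    -- initial one.
    exact h2.mem_LSPaths (h2.ge.mem_weylOrbit_left (hdesc.ge.mem_weylOrbit hν))

theorem eZero_mem_withZero {lam : D.RealWeight} (i : I) (r : ℝ) {x : Option D.Path}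
    (hx : x ∈ CrystalData.withZero (D.LSPaths lam)) :
    D.pathCrystal.eZero i r x ∈ CrystalData.withZero (D.LSPaths lam) := by
  rcases hx with rfl | ⟨π, hπ, rfl⟩
  · exact Or.inl rfl
  · cases h : D.pathE i r π with
    | none => exact Or.inl h
    | some η => exact Or.inr ⟨η, mem_LSPaths_of_pathE hπ h, h.symm⟩

/-- A subset stable under the operators `ẽ_i^r` is a subcrystal. -/
theorem IsContinuousCrystal.isSubcrystal {B : Type*} {X : CrystalData I D.RealWeight B}
    (hX : D.IsContinuousCrystal X) {S : Set B}
    (hS : ∀ i r, ∀ b ∈ S, ∀ b', X.e i r b = some b' → b' ∈ S) : D.IsSubcrystal X S := by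
  let Y : CrystalData I D.RealWeight S :=
    { wt := fun b => X.wt b
      ε := fun i b => X.ε i b
      φ := fun i b => X.φ i b
      e := fun i r b => (X.e i r b).pmap (fun b' h => (⟨b', h⟩ : S)) (hS i r b b.2) }
  have hY : ∀ i r (b : S), (Y.e i r b).map Subtype.val = X.e i r b := by
    intro i r b
    simp [Y, Option.map_pmap]
  have hY' : ∀ i r (b b' : S), Y.e i r b = some b' → X.e i r b = some (b' : B) := by
    intro i r b b' h
    rw [← hY, h, Option.map_some]
  have hinj := Option.map_injective (Subtype.val_injective (p := (· ∈ S)))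
  refine ⟨hX, Y, fun _ => rfl, fun _ _ => rfl, fun _ _ => rfl, hY, ?_⟩
  exact
    { phi_eq := fun i b => hX.phi_eq i b
      eps_e := fun i r b b' h => hX.eps_e i r b b' (hY' i r b b' h)
      phi_e := fun i r b b' h => hX.phi_e i r b b' (hY' i r b b' h)
      wt_e := fun i r b b' h => hX.wt_e i r b b' (hY' i r b b' h)
      e_zero := fun i b => hinj (by rw [hY, hX.e_zero, Option.map_some])
      e_add := fun i r s b b' h =>
        hinj (by rw [hY, hY, hX.e_add i r s b b' (hY' i r b b' h)])
      e_bot := fun i r b hr h => hinj (by rw [hY, hX.e_bot i r b hr h, Option.map_none]) }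

/-! ### Generation from the straight path. -/

theorem straightPath_mem_LSPaths (lam : D.RealWeight) : D.straightPath lam ∈ D.LSPaths lam := by
  refine Descending.mem_LSPaths (ν' := lam) ⟨1, one_mem _, rfl⟩
    (Descending.nil.snoc unitInterval.nonneg' .refl fun t _ _ => ?_)
  simp [straightPath]

/-- No step leaves a dominant weight, so every direction equals λ. -/
theorem Descending.eq_straightPath {lam ν' : D.RealWeight} (hlam : lam ∈ D.closedChamber)
    {π : D.Path} (h : Descending π.toFun 0 lam 1 ν') : π = D.straightPath lam := by
  have key : ∀ b μ, Descending π.toFun 0 lam b μ → ∀ t ≤ b, π.toFun t = (t : ℝ) • lam := by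
    intro b μ hb
    induction hb with
    | nil =>
      intro t ht
      rw [le_antisymm ht unitInterval.nonneg', π.zero_start]
      simp
    | @snoc b b' ν' ν'' hdesc hb hge haff ih =>
      intro t ht
      rcases le_total t b with htb | htb
      · exact ih t htb
      · rw [haff t htb ht, ih b le_rfl,
          eq_of_ge_of_mem_closedChamber hlam (hdesc.ge.trans hge)]
        module
  ext1
  funext t
  exact key 1 ν' h t unitInterval.le_one'

theorem Descending.mem_generatedPaths {lam : D.RealWeight} (hlam : lam ∈ D.closedChamber)
    {ν : D.RealWeight} (hν : ν ∈ D.weylOrbit lam) :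
    ∀ {π : D.Path} {ν' : D.RealWeight}, Descending π.toFun 0 ν 1 ν' →
      π ∈ D.generatedPaths (D.straightPath lam) := by
  refine weylOrbit_induction hlam (motive := fun ν => ∀ {π : D.Path} {ν' : D.RealWeight},
    Descending π.toFun 0 ν 1 ν' → π ∈ D.generatedPaths (D.straightPath lam)) ?_ ?_ hν
  · intro π ν' h
    exact ⟨[], by rw [h.eq_straightPath hlam]; rfl⟩
  · intro i ν hneg ih π ν' h
    have hm := minHeight_nonpos i π
    obtain ⟨η, hη⟩ := (exists_pathE_iff i (-D.minHeight i π) π).2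
      ⟨by linarith [minHeight_le_height_one i π], le_rfl⟩
    -- For the maximal parameter r = −m_i the second condition on the initial bound is vacuous, so
    -- s_i ν is allowed.
    obtain ⟨κ', h'⟩ := h.pathE_of_nonneg (toFun_pathE_of_nonneg hη (by linarith)) le_rfl
      (by rw [chamberSide_of_neg hneg]; exact .refl) (fun h => absurd h (lt_irrefl _))
    obtain ⟨l, hl⟩ := ih h'
    -- Additivity of ẽ_i in its parameter shows that f̃_i with parameter −m_i takes η back to π.
    have hback := pathE_add (D.minHeight i π) hη
    rw [neg_add_cancel, pathE_zero] at hback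
    refine ⟨(i, ⟨-D.minHeight i π, by linarith⟩) :: l, ?_⟩
    change D.pathCrystal.eZero i (-(-D.minHeight i π)) (D.applyF l (D.straightPath lam)) = some π
    rw [hl, neg_neg]
    exact hback.symm

theorem mem_LSPaths_of_applyF {lam : D.RealWeight} {π : D.Path} (hπ : π ∈ D.LSPaths lam)
    (l : List (I × NNReal)) {η : D.Path} (h : D.applyF l π = some η) : η ∈ D.LSPaths lam := by
  induction l generalizing η with
  | nil =>
    obtain rfl : π = η := Option.some.inj h
    exact hπ
  | cons p l ih =>
    obtain ⟨ξ, hξ, h'⟩ := Option.bind_eq_some_iff.1 h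
    exact mem_LSPaths_of_pathE (ih hξ) h'

end CartanDatum

theorem proposition4p2 {I Pd : Type*} [Fintype I] [AddCommGroup Pd] [Module.Free ℤ Pd]
    [Module.Finite ℤ Pd] (D : CartanDatum I Pd) (lam : D.RealWeight)
    (hlam : lam ∈ D.closedChamber) :
    (∀ (i : I) (r : ℝ), ∀ x ∈ CrystalData.withZero (D.LSPaths lam),
      D.pathCrystal.eZero i r x ∈ CrystalData.withZero (D.LSPaths lam)) ∧
    D.IsSubcrystal D.pathCrystal (D.LSPaths lam) ∧
    D.LSPaths lam = D.generatedPaths (D.straightPath lam) := by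
  refine ⟨fun i r x hx => CartanDatum.eZero_mem_withZero i r hx,
    D.isContinuousCrystal_pathCrystal.isSubcrystal fun i r π hπ η h =>
      CartanDatum.mem_LSPaths_of_pathE hπ h, ?_⟩
  ext π
  constructor
  · intro h
    obtain ⟨ν, hν, ν', hdesc⟩ := CartanDatum.mem_LSPaths_iff.1 h
    exact hdesc.mem_generatedPaths hlam hν
  · rintro ⟨l, hl⟩
    exact CartanDatum.mem_LSPaths_of_applyF (D.straightPath_mem_LSPaths lam) l hl
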